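/- Let $\mathbf U$ be the open unit disk in $\mathbf C$, let $1<p\le\infty$, and let $q\in[1,\infty)$ be the conjugate exponent, $\frac1p+\frac1q=1$ (with $\frac1\infty=0$). For a harmonic function $w$ on $\mathbf U$ put $$\|w\|_{h^p}=\sup_{0<\rho<1}\Big(\int_{-\pi}^{\pi}|w(\rho e^{i\theta})|^p\,d\theta\Big)^{1/p}\quad(p<\infty),\qquad \|w\|_{h^\infty}=\sup_{z\in\mathbf U}|w(z)|,$$ and write $w\in h^p$ if $\|w\|_{h^p}<\infty$. Let $Dw(z)$ be the real differential of $w$ at $z$, an $\mathbf R$-linear map on $\mathbf C=\mathbf R^2$, and $|Dw(z)|=\max_{|l|=1}|Dw(z)l|$. For $z=re^{i\alpha}$, $0\le r<1$, and $\tau\in\mathbf R$ put $$C_p(z,e^{i\tau})=\frac1\pi\left(\int_{-\pi}^{\pi}\frac{|\cos(s+\tau-\alpha)|^q}{(1+r^2-2r\cos s)^{1-q}}\,ds\right)^{1/q}$$ (for $z=0$ this does not depend on $\alpha$ and $\tau$). For $z\ne0$ let $\mathbf n=z/|z|$, $\mathbf t=iz/|z|$, and put $C_p(z)=C_p(z,\mathbf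 n)$ if $p<2$ and $C_p(z)=C_p(z,\mathbf t)$ if $p\ge2$; let $C_p(0)$ be the common value of $C_p(0,e^{i\tau})$. a) Let $z=re^{i\alpha}\in\mathbf U$, $z\neq0$, and $\tau\in\mathbf R$. For all complex harmonic $w\in h^p$, $$|Dw(z)e^{i\tau}|\le C_p(z,e^{i\tau})(1-r^2)^{-1/p-1}\|w\|_{h^p},\qquad |Dw(z)|\le C_p(z)(1-r^2)^{-1/p-1}\|w\|_{h^p},$$ and both inequalities are sharp: for each such $z$ and $\tau$ the constants $C_p(z,e^{i\tau})$ and $C_p(z)$ cannot be replaced by smaller ones. Moreover $C_p(z,\mathbf t)\le C_p(z,e^{i\tau})\le C_p(z,\mathbf n)$ if $p<2$, and $C_p(z,\mathbf n)\le C_p(z,e^{i\tau})\le C_p(z,\mathbf t)$ if $p\ge2$. b) If $p\ge2$ and $z\in\mathbf U$, $z\ne0$, $r=|z|$, then $$C_p(z)=\frac{2^{1/q}}{\pi}\left(\mathrm B\Big(\frac{1+q}2,\frac12\Big)\,F\Big(1-\frac{3q}2,1-q;1+\frac q2;r^2\Big)\right)^{1/q},$$ where $\mathrm B$ is the Beta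 function and $F$ the Gauss hypergeometric function. c) The supremum $C_p:=\sup_{z\in\mathbf U}C_p(z)$ is finite and equals $$\frac1\pi\left(\int_{-\pi}^{\pi}\frac{|\cos s|^q}{(2-2\cos s)^{1-q}}\,ds\right)^{1/q}\ \text{ if } 1<p<2,\qquad \frac1\pi\left(\int_{-\pi}^{\pi}\frac{|\sin s|^q}{(2-2\cos s)^{1-q}}\,ds\right)^{1/q}\ \text{ if } p\ge2.$$ It is the smallest constant $C$ such that $|Dw(z)|\le C(1-|z|^2)^{-1/p-1}\|w\|_{h^p}$ for all $z\in\mathbf U$ and all complex harmonic $w\in h^p$, and it is also the smallest such constant when only real harmonic functions $w\in h^p$ are admitted. -/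

import Mathlib

open Set Metric MeasureTheory
open scoped ENNReal

noncomputable section

namespace HarmonicHardy

variable {F : Type*} [NormedAddCommGroup F] [NormedSpace ℝ F]

/-- The Hardy norm of a function on the unit disk, with respect to arc length `dθ` on the circle:
`sup_{0<ρ<1} (∫_{-π}^{π} |w(ρ e^{iθ})|^p dθ)^{1/p}` for `p < ∞`, and the supremum over `0 < ρ < 1`
of the essential supremum of `|w|` on the circle of radius `ρ` for `p = ∞`.
It takes values in `[0, ∞]`. -/
def hardyNorm (p : ℝ≥0∞) (w : ℂ → F) : ℝ≥0∞ :=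
  ⨆ ρ ∈ Ioo (0 : ℝ) 1,
    eLpNorm (fun θ : ℝ => w (ρ * Complex.exp (θ * Complex.I))) p
      (volume.restrict (Ioc (-Real.pi) Real.pi))

/-- The harmonic Hardy class `h^p` of the unit disk. Take `F = ℂ` for complex harmonic functions
and `F = ℝ` for real harmonic functions. -/
def MemHardy (p : ℝ≥0∞) (w : ℂ → F) : Prop :=
  InnerProductSpace.HarmonicOnNhd w (ball 0 1) ∧ hardyNorm p w < ∞

/-- The weight `(1 - |z|²)^{-1/p-1}`. -/
def weight (p : ℝ≥0∞) (z : ℂ) : ℝ :=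
  (1 - ‖z‖ ^ 2) ^ (-(1 / p).toReal - 1)

/-- The directional constant `C_p(z, l)`, where `q` is the exponent conjugate to `p` and `l` is a
unit vector: with `z = r e^{iα}` and `l = e^{iτ}` it is
`(1/π) (∫_{-π}^{π} |cos (s + τ - α)|^q / (1 + r² - 2 r cos s)^{1-q} ds)^{1/q}`. -/
def dirConst (q : ℝ) (z l : ℂ) : ℝ :=
  1 / Real.pi * (∫ s in (-Real.pi)..Real.pi,
    |Real.cos (s + l.arg - z.arg)| ^ q /
      (1 + ‖z‖ ^ 2 - 2 * ‖z‖ * Real.cos s) ^ (1 - q)) ^ (1 / q)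

/-- The formula for `C_p(r e^{iα}, e^{iτ})` holds with any choice of the angles `α`, `τ`. -/
theorem dirConst_polar (q r α τ : ℝ) (hr : 0 < r) :
    dirConst q (r * Complex.exp (α * Complex.I)) (Complex.exp (τ * Complex.I)) =
      1 / Real.pi * (∫ s in (-Real.pi)..Real.pi,
        |Real.cos (s + τ - α)| ^ q /
          (1 + r ^ 2 - 2 * r * Real.cos s) ^ (1 - q)) ^ (1 / q) := by
  have hn : ‖(r : ℂ) * Complex.exp (α * Complex.I)‖ = r := by
    rw [norm_mul, Complex.norm_exp_ofReal_mul_I, Complex.norm_real, Real.norm_eq_abs,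
      abs_of_pos hr, mul_one]
  have key : ∀ s : ℝ, Real.cos (s + (Complex.exp (τ * Complex.I)).arg -
      ((r : ℂ) * Complex.exp (α * Complex.I)).arg) = Real.cos (s + τ - α) := by
    intro s
    rw [Complex.arg_real_mul _ hr, Complex.arg_exp_mul_I, Complex.arg_exp_mul_I,
      ← Real.Angle.cos_coe, ← Real.Angle.cos_coe, Real.Angle.coe_sub, Real.Angle.coe_add,
      Real.Angle.coe_toIocMod, Real.Angle.coe_toIocMod, ← Real.Angle.coe_add,
      ← Real.Angle.coe_sub]
  simp only [dirConst, hn, key]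

/-- The radial unit vector `n = z / |z|`. -/
def normalDir (z : ℂ) : ℂ := z / ‖z‖

/-- The tangential unit vector `t = i z / |z|`. -/
def tangentDir (z : ℂ) : ℂ := Complex.I * (z / ‖z‖)

open Classical in
/-- The constant `C_p(z)`: it is `C_p(z, n)` for `p < 2` and `C_p(z, t)` for `p ≥ 2`.
(At `z = 0` the value of `C_p(0, l)` does not depend on the direction, because the integrand has
period `2π`; the conventions `0 / 0 = 0` and `arg 0 = 0` give this common value.) -/
def gradConst (p : ℝ≥0∞) (q : ℝ) (z : ℂ) : ℝ :=
  if p < 2 then dirConst q z (normalDir z) else dirConst q z (tangentDir z)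

open Classical in
/-- The explicit value of the constant `C_p`. -/
def optConst (p : ℝ≥0∞) (q : ℝ) : ℝ :=
  if p < 2 then
    1 / Real.pi * (∫ s in (-Real.pi)..Real.pi,
      |Real.cos s| ^ q / (2 - 2 * Real.cos s) ^ (1 - q)) ^ (1 / q)
  else
    1 / Real.pi * (∫ s in (-Real.pi)..Real.pi,
      |Real.sin s| ^ q / (2 - 2 * Real.cos s) ^ (1 - q)) ^ (1 / q)

end HarmonicHardy

end

noncomputable section

namespace HarmonicHardy

open Filter Topology Real

/-! By Poisson's formula, a function harmonic near the closed disk satisfies `Dw(z) l = (1/π) ∫ K(t)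
w(e^{it}) dt` with `K(t) = Re (e^{it} l / (e^{it} - z)²)`. Hölder's inequality on the dilates `w(ρ
·)`, followed by `ρ → 1`, bounds `|Dw(z) l|` by `(1/π) ‖K‖_q ‖w‖_{h^p}`. The Möbius substitution
`e^{it} = (e^{is} + z)/(1 + z̄ e^{is})` turns `∫ |K|^q` into `(1 - r²)^{1-2q} ∫ |cos(s + τ - α)|^q
|1 - r e^{is}|^{2(q-1)} ds` (`integral_abs_gradKernel_rpow`), which is the stated constant and
weight. Sharpness comes from the equality case of Hölder: the Poisson integral of `|K|^{q-1} sign K`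
is an extremal real harmonic function, because Poisson integrals do not increase `L^p` norms
(`hardyNorm_re_herglotz_le`, `exists_extremal`).

The extremal direction is a rearrangement fact. Since `|cos|^q` has period `π`, the weight may be
symmetrized under `s ↦ s + π`. The symmetrized weight is a function of `|cos s|`, increasing if `q ≥
2` (`x^{q-1}` convex) and decreasing if `q ≤ 2` (`x^{q-1}` concave). A Chebyshev-type inequality
then locates the extremal shifts at `0` and `π/2` (`dirIntegral_extremal`).

For `p ≥ 2`, integration by parts yields a second-order equation in `r` for the extremal integral,
the same one as for `₂F₁(1 - 3q/2, 1 - q; 1 + q/2; r²)`. A weighted Wronskian that vanishes at `0`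
shows that the two are proportional, and the value at `r = 0` is a Beta function
(`moment_eq_hypergeometric`).

Finally the extremal integral is increasing in `r` and continuous up to `r = 1`, so the supremum
over the disk is its value at `r = 1`. Pointwise sharpness makes this the best global constant, and
real extremals settle the real and the complex problem together. -/

/-- The point `e^{iθ}` of the unit circle. -/
def circ (θ : ℝ) : ℂ := Complex.exp (θ * Complex.I)

@[simp] lemma norm_circ (θ : ℝ) : ‖circ θ‖ = 1 := Complex.norm_exp_ofReal_mul_I θ

@[fun_prop] lemma continuous_circ : Continuous circ := by unfold circ; fun_prop

lemma circ_ne_zero (θ : ℝ) : circ θ ≠ 0 := Complex.exp_ne_zero _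

lemma circ_periodic : Function.Periodic circ (2 * π) := by
  intro θ
  simp only [circ, Complex.ofReal_add, add_mul]
  push_cast
  rw [Complex.exp_periodic]

lemma circleMap_eq_circ (θ : ℝ) : circleMap 0 1 θ = circ θ := by simp [circleMap, circ]

lemma one_sub_norm_le_norm_circ_sub (t : ℝ) (z : ℂ) : 1 - ‖z‖ ≤ ‖circ t - z‖ := by
  simpa using norm_sub_norm_le (circ t) z

lemma circ_sub_ne_zero {z : ℂ} (hz : z ∈ ball (0 : ℂ) 1) (t : ℝ) : circ t - z ≠ 0 := by
  rw [← norm_pos_iff]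
  have := one_sub_norm_le_norm_circ_sub t z
  have : ‖z‖ < 1 := by simpa using hz
  linarith

/-! ### Herglotz integrals and Poisson's formula for the derivative -/

/-- The Herglotz integral of a real function on the circle. -/
def herglotz (φ : ℝ → ℝ) (z : ℂ) : ℂ :=
  (2 * π : ℂ)⁻¹ * ∫ t in (-π)..π, (circ t + z) / (circ t - z) * (φ t : ℂ)

/-- The kernel of the derivative, in direction `l`, of the Poisson integral at `z`. -/
def gradKernel (z l : ℂ) (t : ℝ) : ℝ := (circ t * l / (circ t - z) ^ 2).re

@[fun_prop] lemma continuous_gradKernel {z : ℂ} (hz : z ∈ ball (0 : ℂ) 1) (l : ℂ) :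
    Continuous (gradKernel z l) := by
  unfold gradKernel
  refine Complex.continuous_re.comp (Continuous.div (by fun_prop) (by fun_prop) ?_)
  exact fun t => pow_ne_zero _ (circ_sub_ne_zero hz t)

lemma intervalIntegrable_ofReal {φ : ℝ → ℝ} {a b : ℝ} (hφ : IntervalIntegrable φ volume a b) :
    IntervalIntegrable (fun t => (φ t : ℂ)) volume a b :=
  ⟨hφ.1.ofReal, hφ.2.ofReal⟩

lemma hasDerivAt_herglotz {φ : ℝ → ℝ} (hφ : IntervalIntegrable φ volume (-π) π) {z : ℂ}
    (hz : z ∈ ball (0 : ℂ) 1) :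
    HasDerivAt (herglotz φ)
      ((2 * π : ℂ)⁻¹ * ∫ t in (-π)..π, 2 * circ t / (circ t - z) ^ 2 * (φ t : ℂ)) z := by
  have hz' : ‖z‖ < 1 := by simpa using hz
  -- Half the distance from `z` to the circle: on the ball of radius `δ` about `z` every denominator
  -- `e^{it} - x` has modulus at least `δ`, which gives the dominating function.
  set δ := (1 - ‖z‖) / 2 with hδ
  have hδ0 : 0 < δ := by simp only [hδ]; linarith
  have hball : ∀ x ∈ ball z δ, x ∈ ball (0 : ℂ) 1 ∧ ∀ t, δ ≤ ‖circ t - x‖ := by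
    intro x hx
    have hx' : ‖x - z‖ < δ := by simpa [dist_eq_norm] using hx
    have h1 : ‖x‖ ≤ ‖x - z‖ + ‖z‖ := by simpa using norm_add_le (x - z) z
    refine ⟨by simp only [mem_ball_zero_iff]; linarith, fun t => ?_⟩
    have := one_sub_norm_le_norm_circ_sub t x
    linarith
  have hφC : IntervalIntegrable (fun t => (φ t : ℂ)) volume (-π) π :=
    intervalIntegrable_ofReal hφ
  have hcont : ∀ x ∈ ball (0 : ℂ) 1,
      Continuous (fun t => (circ t + x) / (circ t - x)) := fun x hx =>
    Continuous.div (by fun_prop) (by fun_prop) (circ_sub_ne_zero hx)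
  have hcont' : Continuous (fun t => 2 * circ t / (circ t - z) ^ 2) :=
    Continuous.div (by fun_prop) (by fun_prop) (fun t => pow_ne_zero _ (circ_sub_ne_zero hz t))
  refine HasDerivAt.const_mul _ ?_
  refine (intervalIntegral.hasDerivAt_integral_of_dominated_loc_of_deriv_le
    (F := fun x t => (circ t + x) / (circ t - x) * (φ t : ℂ))
    (F' := fun x t => 2 * circ t / (circ t - x) ^ 2 * (φ t : ℂ))
    (bound := fun t => 2 / δ ^ 2 * ‖φ t‖)
    (ball_mem_nhds z hδ0) ?_ ?_ ?_ ?_ ?_ ?_).2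
  · filter_upwards [ball_mem_nhds z hδ0] with x hx
    exact (hcont x (hball x hx).1).aestronglyMeasurable.mul hφC.def'.aestronglyMeasurable
  · exact hφC.continuousOn_mul (hcont z hz).continuousOn
  · exact hcont'.aestronglyMeasurable.mul hφC.def'.aestronglyMeasurable
  · refine Eventually.of_forall fun t _ x hx => ?_
    rw [norm_mul, norm_div, norm_mul, norm_pow, norm_circ, Complex.norm_real]
    have := (hball x hx).2 t
    simp only [Complex.norm_ofNat, mul_one]
    gcongr
  · exact hφ.norm.const_mul _
  · refine Eventually.of_forall fun t _ x hx => ?_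
    have hne := circ_sub_ne_zero (hball x hx).1 t
    have := ((hasDerivAt_id x).const_add (circ t)).div ((hasDerivAt_id x).const_sub (circ t)) hne
    refine (this.mul_const (φ t : ℂ)).congr_deriv ?_
    simp only [id]
    ring

/-- The real differential of `Re f` for holomorphic `f` is `l ↦ Re (l f'(z))`. The `2` from
differentiating the Herglotz kernel cancels the one in `1/(2π)`. -/
lemma fderiv_re_herglotz {φ : ℝ → ℝ} (hφ : IntervalIntegrable φ volume (-π) π) {z : ℂ}
    (hz : z ∈ ball (0 : ℂ) 1) (l : ℂ) :
    fderiv ℝ (fun x => (herglotz φ x).re) z l =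
      1 / π * ∫ t in (-π)..π, gradKernel z l t * φ t := by
  have h1 := (hasDerivAt_herglotz hφ hz).hasFDerivAt.restrictScalars ℝ
  have h2 := Complex.reCLM.hasFDerivAt.comp z h1
  have h3 : (Complex.reCLM ∘ herglotz φ) = fun x => (herglotz φ x).re := rfl
  rw [h3] at h2
  rw [h2.fderiv]
  have hcont' : Continuous (fun t => 2 * circ t / (circ t - z) ^ 2) :=
    Continuous.div (by fun_prop) (by fun_prop) (fun t => pow_ne_zero _ (circ_sub_ne_zero hz t))
  have hi : IntervalIntegrable (fun t => l * (2 * π : ℂ)⁻¹ *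
      (2 * circ t / (circ t - z) ^ 2 * (φ t : ℂ))) volume (-π) π :=
    ((intervalIntegrable_ofReal hφ).continuousOn_mul hcont'.continuousOn).const_mul _
  simp only [ContinuousLinearMap.comp_apply, ContinuousLinearMap.coe_restrictScalars',
    ContinuousLinearMap.toSpanSingleton_apply, smul_eq_mul]
  rw [← mul_assoc, ← intervalIntegral.integral_const_mul,
    ← ContinuousLinearMap.intervalIntegral_comp_comm _ hi, ← intervalIntegral.integral_const_mul]
  refine intervalIntegral.integral_congr fun t _ => ?_
  simp only [Complex.reCLM_apply, gradKernel]
  rw [show l * (2 * π : ℂ)⁻¹ * (2 * circ t / (circ t - z) ^ 2 * (φ t : ℂ)) =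
    ((π⁻¹ * φ t : ℝ) : ℂ) * (circ t * l / (circ t - z) ^ 2) by push_cast; field_simp]
  rw [Complex.re_ofReal_mul]
  ring

lemma harmonicOnNhd_re_herglotz {φ : ℝ → ℝ} (hφ : IntervalIntegrable φ volume (-π) π) :
    InnerProductSpace.HarmonicOnNhd (fun x => (herglotz φ x).re) (ball 0 1) := by
  intro z hz
  have : DifferentiableOn ℂ (herglotz φ) (ball 0 1) := fun x hx =>
    (hasDerivAt_herglotz hφ hx).differentiableAt.differentiableWithinAt
  exact (this.analyticAt (isOpen_ball.mem_nhds hz)).harmonicAt_re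

lemma re_herglotz_eq {φ : ℝ → ℝ} (hφ : IntervalIntegrable φ volume (-π) π) {z : ℂ}
    (hz : z ∈ ball (0 : ℂ) 1) :
    (herglotz φ z).re =
      (2 * π)⁻¹ * ∫ t in (-π)..π, ((circ t + z) / (circ t - z)).re * φ t := by
  have hcont : Continuous (fun t => (circ t + z) / (circ t - z)) :=
    Continuous.div (by fun_prop) (by fun_prop) (circ_sub_ne_zero hz)
  have hi := (intervalIntegrable_ofReal hφ).continuousOn_mul hcont.continuousOn
  rw [herglotz, show (2 * π : ℂ)⁻¹ = ((2 * π : ℝ)⁻¹ : ℝ) by push_cast; rfl, Complex.re_ofReal_mul,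
    ← Complex.reCLM_apply, ← ContinuousLinearMap.intervalIntegral_comp_comm _ hi]
  congr 1
  refine intervalIntegral.integral_congr fun t _ => ?_
  simp only [Complex.reCLM_apply, Complex.re_mul_ofReal]

/-- Poisson's formula: a harmonic function is the real part of the Herglotz integral of its
boundary values. -/
lemma re_herglotz_of_harmonic {u : ℂ → ℝ}
    (hu : InnerProductSpace.HarmonicOnNhd u (closedBall 0 1)) {z : ℂ}
    (hz : z ∈ ball (0 : ℂ) 1) : (herglotz (fun t => u (circ t)) z).re = u z := by
  have hc : Continuous (fun t => u (circ t)) :=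
    hu.continuousOn.comp_continuous continuous_circ (fun t => by simp)
  rw [re_herglotz_eq (hc.intervalIntegrable _ _) hz,
    ← hu.circleAverage_re_herglotzRieszKernel_smul hz, circleAverage_def, smul_eq_mul]
  congr 1
  simp only [circleMap_eq_circ, Pi.smul_apply', Function.comp, herglotzRieszKernel_def, sub_zero,
    smul_eq_mul]
  have hp : Function.Periodic (fun t => ((circ t + z) / (circ t - z)).re * u (circ t)) (2 * π) :=
    fun t => by simp only [circ_periodic t]
  have := hp.intervalIntegral_add_eq (-π) 0
  rwa [show -π + 2 * π = π by ring, zero_add] at this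

lemma fderiv_real_harmonic {u : ℂ → ℝ}
    (hu : InnerProductSpace.HarmonicOnNhd u (closedBall 0 1)) {z : ℂ}
    (hz : z ∈ ball (0 : ℂ) 1) (l : ℂ) :
    fderiv ℝ u z l = 1 / π * ∫ t in (-π)..π, gradKernel z l t * u (circ t) := by
  have hc : Continuous (fun t => u (circ t)) :=
    hu.continuousOn.comp_continuous continuous_circ (fun t => by simp)
  rw [← fderiv_re_herglotz (hc.intervalIntegrable _ _) hz]
  have : u =ᶠ[𝓝 z] fun x => (herglotz (fun t => u (circ t)) x).re := by
    filter_upwards [isOpen_ball.mem_nhds hz] with x hx using (re_herglotz_of_harmonic hu hx).symm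
  rw [this.fderiv_eq]

lemma fderiv_complex_harmonic {w : ℂ → ℂ}
    (hw : InnerProductSpace.HarmonicOnNhd w (closedBall 0 1)) {z : ℂ}
    (hz : z ∈ ball (0 : ℂ) 1) (l : ℂ) :
    fderiv ℝ w z l = (1 / π : ℂ) * ∫ t in (-π)..π, gradKernel z l t • w (circ t) := by
  have hc : Continuous (fun t => w (circ t)) :=
    hw.continuousOn.comp_continuous continuous_circ (fun t => by simp)
  have hd : DifferentiableAt ℝ w z :=
    (hw z (ball_subset_closedBall hz)).1.differentiableAt (by norm_num)
  have hi : IntervalIntegrable (fun t => gradKernel z l t • w (circ t)) volume (-π) π :=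
    ((continuous_gradKernel hz l).smul hc).intervalIntegrable _ _
  -- Composing with a real functional reduces to the real case; the real and imaginary parts then
  -- determine the complex value.
  have key : ∀ L : ℂ →L[ℝ] ℝ, L (fderiv ℝ w z l) =
      1 / π * L (∫ t in (-π)..π, gradKernel z l t • w (circ t)) := by
    intro L
    have h := fderiv_real_harmonic (u := L ∘ w) (hw.comp_CLM L) hz l
    rw [fderiv_comp z L.differentiableAt hd, L.fderiv] at h
    rw [← ContinuousLinearMap.intervalIntegral_comp_comm _ hi]
    simpa [-Complex.real_smul] using h
  apply Complex.ext
  · have := key Complex.reCLM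
    simp only [Complex.reCLM_apply] at this
    rw [this, ← Complex.re_ofReal_mul]; simp
  · have := key Complex.imCLM
    simp only [Complex.imCLM_apply] at this
    rw [this, ← Complex.im_ofReal_mul]; simp

/-! ### The Möbius substitution -/

/-- The squared distance `|1 - r e^{is}|²`. -/
def sqDist (r s : ℝ) : ℝ := 1 + r ^ 2 - 2 * r * Real.cos s

lemma sqDist_nonneg (r s : ℝ) : 0 ≤ sqDist r s := by
  unfold sqDist
  nlinarith [sq_nonneg (r - Real.cos s), Real.sin_sq_add_cos_sq s, sq_nonneg (Real.sin s)]

lemma sqDist_pos {r : ℝ} (hr : 0 ≤ r) (hr1 : r < 1) (s : ℝ) : 0 < sqDist r s := by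
  unfold sqDist
  nlinarith [Real.cos_le_one s, mul_nonneg hr (sub_nonneg.2 (Real.cos_le_one s)),
    mul_pos (sub_pos.2 hr1) (sub_pos.2 hr1)]

/-- `∫_{-π}^{π} |cos (s + τ)|^q |1 - r e^{is}|^{2(q-1)} ds`. -/
def dirIntegral (q r τ : ℝ) : ℝ :=
  ∫ s in (-π)..π, |Real.cos (s + τ)| ^ q * sqDist r s ^ (q - 1)

/-- With the nonnegative exponent `q - 1` the integrand is visibly continuous up to `r = 1`. The
identity also holds where the distance vanishes, by the conventions for `0 ^ x` and division by
zero. -/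
lemma div_sqDist_rpow (x r s q : ℝ) :
    x / sqDist r s ^ (1 - q) = x * sqDist r s ^ (q - 1) := by
  rw [div_eq_mul_inv, ← Real.rpow_neg (sqDist_nonneg r s), neg_sub]

lemma dirConst_circ (q : ℝ) (z : ℂ) (τ : ℝ) :
    dirConst q z (circ τ) = 1 / π * dirIntegral q ‖z‖ (τ - z.arg) ^ (1 / q) := by
  have key : ∀ s : ℝ, Real.cos (s + (circ τ).arg - z.arg) = Real.cos (s + (τ - z.arg)) := by
    intro s
    rw [circ, Complex.arg_exp_mul_I, ← Real.Angle.cos_coe, ← Real.Angle.cos_coe,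
      Real.Angle.coe_sub, Real.Angle.coe_add, Real.Angle.coe_toIocMod, ← Real.Angle.coe_add,
      ← Real.Angle.coe_sub, add_sub_assoc]
  simp only [dirConst, dirIntegral, key]
  congr 3
  ext s
  exact div_sqDist_rpow _ _ _ _

/-- The angle `t` with `e^{it} = (e^{is} + z) / (1 + z̄ e^{is})`. -/
def moebiusAngle (z : ℂ) (s : ℝ) : ℝ := s + 2 * (1 + z * circ (-s)).arg

lemma circ_neg (s : ℝ) : circ (-s) = (circ s)⁻¹ := by
  simp [circ, Complex.exp_neg]

lemma circ_add (s t : ℝ) : circ (s + t) = circ s * circ t := by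
  simp [circ, add_mul, Complex.exp_add]

lemma conj_circ (s : ℝ) : (starRingEnd ℂ) (circ s) = circ (-s) := by
  simp [circ, ← Complex.exp_conj]

lemma re_circ (s : ℝ) : (circ s).re = Real.cos s := by
  simp [circ, Complex.exp_ofReal_mul_I_re]

lemma im_circ (s : ℝ) : (circ s).im = Real.sin s := by
  simp [circ, Complex.exp_ofReal_mul_I_im]

lemma norm_mul_circ_lt {z : ℂ} (hz : z ∈ ball (0 : ℂ) 1) (s : ℝ) : ‖z * circ s‖ < 1 := by
  simpa using hz

lemma one_add_mem_slitPlane {x : ℂ} (hx : ‖x‖ < 1) : 1 + x ∈ Complex.slitPlane :=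
  Complex.mem_slitPlane_of_norm_lt_one hx

lemma circ_arg_sq {y : ℂ} (hy : y ≠ 0) : circ (2 * y.arg) = y / (starRingEnd ℂ) y := by
  have h := Complex.norm_mul_exp_arg_mul_I y
  have hn : (‖y‖ : ℂ) ≠ 0 := by simpa using hy
  have h1 : (circ y.arg) = y / ‖y‖ := by rw [circ]; field_simp; rw [mul_comm]; exact h
  have h2 : circ (2 * y.arg) = circ y.arg ^ 2 := by rw [two_mul, circ_add, sq]
  have hc : (starRingEnd ℂ) y ≠ 0 := by simpa using hy
  have h3 := Complex.mul_conj' y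
  rw [h2, h1, div_pow, ← h3, sq]
  field_simp

/-- The angle is `s + 2 Im log(1 + z e^{-is})`, and the principal branch is smooth here because `|z
e^{-is}| < 1` keeps the argument in the slit plane. -/
lemma hasDerivAt_moebiusAngle {z : ℂ} (hz : z ∈ ball (0 : ℂ) 1) (s : ℝ) :
    HasDerivAt (moebiusAngle z) ((1 - ‖z‖ ^ 2) / ‖1 + z * circ (-s)‖ ^ 2) s := by
  have hs := one_add_mem_slitPlane (norm_mul_circ_lt hz (-s))
  have hne := Complex.slitPlane_ne_zero hs
  have h1 : HasDerivAt (fun s : ℝ => 1 + z * circ (-s)) (-Complex.I * (z * circ (-s))) s := by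
    have h0 : HasDerivAt (fun s : ℝ => ((-s : ℝ) : ℂ) * Complex.I) (-1 * Complex.I) s := by
      refine HasDerivAt.mul_const ?_ _
      simpa using (hasDerivAt_neg s).ofReal_comp
    refine ((h0.cexp.const_mul z).const_add 1).congr_deriv ?_
    rw [circ]; ring
  have h2 := h1.clog_real hs
  have h3 := Complex.imCLM.hasFDerivAt.comp_hasDerivAt s h2
  have h4 := (hasDerivAt_id s).add (h3.const_mul 2)
  have h5 : ‖z‖ ^ 2 = Complex.normSq (z * circ (-s)) := by
    rw [Complex.normSq_eq_norm_sq]; simp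
  refine (h4.congr_deriv ?_).congr_of_eventuallyEq (Eventually.of_forall fun x => ?_)
  · rw [h5, ← Complex.normSq_eq_norm_sq]
    generalize z * circ (-s) = x at *
    have hn : Complex.normSq (1 + x) ≠ 0 := by simpa using hne
    simp only [Complex.imCLM_apply, Complex.div_im]
    field_simp
    simp [Complex.normSq_apply]
    ring
  · simp [moebiusAngle, Complex.log_im]

lemma circ_moebiusAngle {z : ℂ} (hz : z ∈ ball (0 : ℂ) 1) (s : ℝ) :
    circ (moebiusAngle z s) =
      circ s * ((1 + z * circ (-s)) / (starRingEnd ℂ) (1 + z * circ (-s))) := by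
  have hne := Complex.slitPlane_ne_zero (one_add_mem_slitPlane (norm_mul_circ_lt hz (-s)))
  rw [moebiusAngle, circ_add, circ_arg_sq hne]

/-- In the new variable `e^{it} - z` equals `e^{is}(1 - |z|²)` divided by the conjugate of `1 + z
e^{-is}`. Hence the complex kernel has phase exactly `τ - s`, and its real part is a cosine times a
positive factor. -/
lemma gradKernel_moebiusAngle {z : ℂ} (hz : z ∈ ball (0 : ℂ) 1) (τ s : ℝ) :
    gradKernel z (circ τ) (moebiusAngle z s) =
      Real.cos (τ - s) * (‖1 + z * circ (-s)‖ ^ 2 / (1 - ‖z‖ ^ 2) ^ 2) := by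
  have hne := Complex.slitPlane_ne_zero (one_add_mem_slitPlane (norm_mul_circ_lt hz (-s)))
  have hne' : (starRingEnd ℂ) (1 + z * circ (-s)) ≠ 0 := (map_ne_zero _).2 hne
  have hz1 : (1 : ℂ) - z * (starRingEnd ℂ) z ≠ 0 := by
    rw [Complex.mul_conj', ← Complex.ofReal_pow, ← Complex.ofReal_one, ← Complex.ofReal_sub,
      Complex.ofReal_ne_zero]
    have : ‖z‖ < 1 := by simpa using hz
    nlinarith [norm_nonneg z]
  have e1 : circ (moebiusAngle z s) - z =
      circ s * (1 - z * (starRingEnd ℂ) z) / (starRingEnd ℂ) (1 + z * circ (-s)) := by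
    rw [circ_moebiusAngle hz, eq_div_iff hne', sub_mul, mul_assoc, div_mul_cancel₀ _ hne']
    simp only [map_add, map_mul, map_one, conj_circ, neg_neg]
    rw [circ_neg]
    field_simp [circ_ne_zero s]
    ring
  have e2 : circ (moebiusAngle z s) * circ τ / (circ (moebiusAngle z s) - z) ^ 2 =
      ((‖1 + z * circ (-s)‖ ^ 2 / (1 - ‖z‖ ^ 2) ^ 2 : ℝ) : ℂ) * circ (τ - s) := by
    rw [e1, circ_moebiusAngle hz]
    push_cast
    rw [← Complex.mul_conj', ← Complex.mul_conj', sub_eq_add_neg τ s, circ_add, circ_neg s]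
    rw [circ_neg] at hne'
    have := circ_ne_zero s
    field_simp
  rw [gradKernel, e2, Complex.re_ofReal_mul, re_circ, mul_comm]

lemma moebiusAngle_pi (z : ℂ) : moebiusAngle z π = moebiusAngle z (-π) + 2 * π := by
  have : circ (- -π) = circ (-π) := by
    have := circ_periodic (-π)
    rw [← this]; congr 1; ring
  rw [moebiusAngle, moebiusAngle, this]; ring

lemma norm_one_add_sq (z : ℂ) (s : ℝ) :
    ‖1 + z * circ (-(z.arg + π - s))‖ ^ 2 = sqDist ‖z‖ s := by
  have h : z * circ (-(z.arg + π - s)) = -(‖z‖ * circ s) := by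
    nth_rw 1 [← Complex.norm_mul_exp_arg_mul_I z]
    change ‖z‖ * circ z.arg * _ = _
    rw [mul_assoc, ← circ_add, show z.arg + -(z.arg + π - s) = s + -π by ring, circ_add]
    have : circ (-π) = -1 := by rw [circ_neg, circ, Complex.exp_pi_mul_I]; norm_num
    rw [this]; ring
  rw [h, ← Complex.normSq_eq_norm_sq, Complex.normSq_apply]
  simp only [Complex.add_re, Complex.one_re, Complex.neg_re, Complex.re_ofReal_mul, re_circ,
    Complex.add_im, Complex.one_im, Complex.neg_im, Complex.im_ofReal_mul, im_circ, sqDist]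
  nlinarith [Real.sin_sq_add_cos_sq s]

/-- The kernel contributes `(1 - |z|²)^{-2q}` and the Jacobian one factor `1 - |z|²`, whence the
exponent `1 - 2q`; likewise `|1 + z e^{-is}|²` enters with power `q - 1`. -/
lemma integral_abs_gradKernel_rpow {q : ℝ} (hq : 0 ≤ q) {z : ℂ} (hz : z ∈ ball (0 : ℂ) 1)
    (τ : ℝ) :
    ∫ t in (-π)..π, |gradKernel z (circ τ) t| ^ q =
      (1 - ‖z‖ ^ 2) ^ (1 - 2 * q) * dirIntegral q ‖z‖ (τ - z.arg) := by
  have hz' : ‖z‖ < 1 := by simpa using hz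
  have hW : 0 < 1 - ‖z‖ ^ 2 := by nlinarith [norm_nonneg z]
  have hne : ∀ s, ‖1 + z * circ (-s)‖ ≠ 0 := fun s => by
    simpa using Complex.slitPlane_ne_zero (one_add_mem_slitPlane (norm_mul_circ_lt hz (-s)))
  have hKc : Continuous (fun t => |gradKernel z (circ τ) t| ^ q) :=
    ((continuous_gradKernel hz _).abs).rpow_const (fun _ => Or.inr hq)
  have hper : Function.Periodic (fun t => |gradKernel z (circ τ) t| ^ q) (2 * π) := fun t => by
    simp only [gradKernel, circ_periodic t]
  have h1 : ∫ t in (-π)..π, |gradKernel z (circ τ) t| ^ q =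
      ∫ s in (-π)..π, |gradKernel z (circ τ) (moebiusAngle z s)| ^ q *
        ((1 - ‖z‖ ^ 2) / ‖1 + z * circ (-s)‖ ^ 2) := by
    have := intervalIntegral.integral_comp_mul_deriv (a := -π) (b := π)
      (fun s _ => hasDerivAt_moebiusAngle hz s)
      (Continuous.continuousOn (by
        refine Continuous.div (by fun_prop) (by fun_prop) fun s => pow_ne_zero _ (hne s))) hKc
    simp only [Function.comp] at this
    rw [this, moebiusAngle_pi, hper.intervalIntegral_add_eq (moebiusAngle z (-π)) (-π)]
    congr 1; ring
  set G : ℝ → ℝ := fun s => |Real.cos (τ - s)| ^ q * (‖1 + z * circ (-s)‖ ^ 2) ^ (q - 1) with hG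
  have h2 : ∫ t in (-π)..π, |gradKernel z (circ τ) t| ^ q =
      (1 - ‖z‖ ^ 2) ^ (1 - 2 * q) * ∫ s in (-π)..π, G s := by
    rw [h1, ← intervalIntegral.integral_const_mul]
    refine intervalIntegral.integral_congr fun s _ => ?_
    have hp : 0 < ‖1 + z * circ (-s)‖ ^ 2 := by
      have := hne s; positivity
    simp only [gradKernel_moebiusAngle hz, hG]
    generalize ‖1 + z * circ (-s)‖ ^ 2 = y at *
    rw [abs_mul, abs_of_pos (show 0 < y / (1 - ‖z‖ ^ 2) ^ 2 by positivity),
      Real.mul_rpow (abs_nonneg _) (by positivity), Real.div_rpow hp.le (by positivity),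
      Real.rpow_sub_one hp.ne', Real.rpow_sub hW, Real.rpow_one, Real.rpow_mul hW.le]
    simp only [Real.rpow_ofNat]
    field_simp
  have hGper : Function.Periodic G (2 * π) := fun s => by
    have : circ (-(s + 2 * π)) = circ (-s) := by
      rw [circ_neg, circ_periodic s, circ_neg]
    simp only [hG, this]
    rw [show τ - (s + 2 * π) = τ - s - 2 * π by ring, Real.cos_sub_two_pi]
  rw [h2]
  congr 1
  -- The reflection `s ↦ arg z + π - s` turns `|1 + z e^{-is}|` into `|1 - r e^{is}|`.
  have h3 := intervalIntegral.integral_comp_sub_left (a := -π) (b := π) G (z.arg + π)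
  rw [show z.arg + π - -π = z.arg + 2 * π by ring, show z.arg + π - π = z.arg by ring,
    hGper.intervalIntegral_add_eq z.arg (-π), show -π + 2 * π = π by ring] at h3
  rw [← h3, dirIntegral]
  refine intervalIntegral.integral_congr fun s _ => ?_
  simp only [hG, norm_one_add_sq]
  rw [show τ - (z.arg + π - s) = (s + (τ - z.arg)) - π by ring, Real.cos_sub_pi, abs_neg]

/-- The norm of the functional `φ ↦ D(P[φ])(z) l` on `L^p` of the circle. -/
def kernelNorm (q : ℝ) (z l : ℂ) : ℝ :=
  1 / π * (∫ t in (-π)..π, |gradKernel z l t| ^ q) ^ (1 / q)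

lemma dirIntegral_nonneg (q r τ : ℝ) : 0 ≤ dirIntegral q r τ := by
  refine intervalIntegral.integral_nonneg (by linarith [pi_pos]) fun s _ => ?_
  have := sqDist_nonneg r s
  positivity

lemma weight_pos (p : ℝ≥0∞) {z : ℂ} (hz : z ∈ ball (0 : ℂ) 1) : 0 < weight p z := by
  have hz' : ‖z‖ < 1 := by simpa using hz
  exact Real.rpow_pos_of_pos (by nlinarith [norm_nonneg z]) _

lemma kernelNorm_eq {p : ℝ≥0∞} {q : ℝ} (hq : 1 ≤ q) (hpq : (1 / p).toReal = 1 - 1 / q) {z : ℂ}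
    (hz : z ∈ ball (0 : ℂ) 1) (τ : ℝ) :
    kernelNorm q z (circ τ) = dirConst q z (circ τ) * weight p z := by
  have hz' : ‖z‖ < 1 := by simpa using hz
  have hW : 0 < 1 - ‖z‖ ^ 2 := by nlinarith [norm_nonneg z]
  have hq0 : q ≠ 0 := by linarith
  rw [kernelNorm, integral_abs_gradKernel_rpow (by linarith) hz, dirConst_circ, weight, hpq,
    Real.mul_rpow (by positivity) (dirIntegral_nonneg _ _ _), ← Real.rpow_mul hW.le]
  rw [show (1 - 2 * q) * (1 / q) = -(1 - 1 / q) - 1 by field_simp; ring]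
  ring

/-! ### Upper bound by Hölder's inequality -/

lemma norm_integral_smul_le {p : ℝ≥0∞} {q : ℝ} (hq : 1 ≤ q)
    (hpq : ENNReal.HolderConjugate p (ENNReal.ofReal q)) {K : ℝ → ℝ} (hK : Continuous K)
    {g : ℝ → ℂ} (hg : Continuous g) {N : ℝ} (hN : 0 ≤ N)
    (hgN : eLpNorm g p (volume.restrict (Ioc (-π) π)) ≤ ENNReal.ofReal N) :
    ‖∫ t in (-π)..π, K t • g t‖ ≤ (∫ t in (-π)..π, |K t| ^ q) ^ (1 / q) * N := by
  set μ := volume.restrict (Ioc (-π) π)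
  have hpi : -π ≤ π := by linarith [pi_pos]
  have hKm : MemLp K (ENNReal.ofReal q) μ := by
    obtain ⟨C, hC⟩ := (isCompact_Icc (a := -π) (b := π)).exists_bound_of_continuousOn
      hK.continuousOn
    refine MemLp.of_bound hK.aestronglyMeasurable C ?_
    filter_upwards [ae_restrict_mem measurableSet_Ioc] with t ht using hC t (Ioc_subset_Icc_self ht)
  have hq0 : ENNReal.ofReal q ≠ 0 := by simp; linarith
  have hKn := hKm.eLpNorm_eq_integral_rpow_norm hq0 ENNReal.ofReal_ne_top
  rw [ENNReal.toReal_ofReal (by linarith)] at hKn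
  have := hpq.symm
  have h1 : eLpNorm (K • g) 1 μ ≤ eLpNorm K (ENNReal.ofReal q) μ * eLpNorm g p μ :=
    eLpNorm_smul_le_mul_eLpNorm hg.aestronglyMeasurable hK.aestronglyMeasurable
  have h2 : ‖∫ t in (-π)..π, K t • g t‖ₑ ≤ eLpNorm (K • g) 1 μ := by
    rw [intervalIntegral.integral_of_le hpi, eLpNorm_one_eq_lintegral_enorm]
    exact enorm_integral_le_lintegral_enorm _
  have hI : 0 ≤ ∫ t in (-π)..π, |K t| ^ q :=
    intervalIntegral.integral_nonneg hpi fun s _ => by positivity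
  have h3 : ‖∫ t in (-π)..π, K t • g t‖ₑ ≤
      ENNReal.ofReal ((∫ t in (-π)..π, |K t| ^ q) ^ (1 / q) * N) := by
    rw [ENNReal.ofReal_mul (by positivity)]
    refine h2.trans (h1.trans (mul_le_mul' (le_of_eq ?_) hgN))
    rw [hKn, one_div, intervalIntegral.integral_of_le hpi]
    simp only [Real.norm_eq_abs, μ]
  rw [← ofReal_norm] at h3
  exact (ENNReal.ofReal_le_ofReal_iff (by positivity)).1 h3

/-- On the disk `u` is the real part of an analytic `f`, and `f(ρ ·)` is analytic near the closed
disk. -/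
lemma harmonicOnNhd_dilate_real {u : ℂ → ℝ}
    (hu : InnerProductSpace.HarmonicOnNhd u (ball 0 1)) {ρ : ℝ} (hρ : ρ ∈ Ioo (0 : ℝ) 1) :
    InnerProductSpace.HarmonicOnNhd (fun z : ℂ => u (ρ * z)) (closedBall 0 1) := by
  obtain ⟨f, hf, hfu⟩ := hu.exists_analyticOnNhd_ball_re_eq
  intro z hz
  have hz1 : (ρ : ℂ) * z ∈ ball (0 : ℂ) 1 := by
    simp only [mem_closedBall_zero_iff] at hz
    simp only [mem_ball_zero_iff, norm_mul, Complex.norm_real, Real.norm_eq_abs, abs_of_pos hρ.1]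
    nlinarith [hρ.1, hρ.2, norm_nonneg z]
  have hc : Continuous (fun z : ℂ => (ρ : ℂ) * z) := by fun_prop
  have h1 : AnalyticAt ℂ (fun z : ℂ => f (ρ * z)) z :=
    (hf _ hz1).comp_of_eq (g := f) (f := fun z : ℂ => (ρ : ℂ) * z) (by fun_prop) rfl
  refine (InnerProductSpace.harmonicAt_congr_nhds ?_).1 h1.harmonicAt_re
  filter_upwards [hc.continuousAt.preimage_mem_nhds (isOpen_ball.mem_nhds hz1)] with x hx
    using hfu hx

lemma harmonicOnNhd_dilate {w : ℂ → ℂ}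
    (hw : InnerProductSpace.HarmonicOnNhd w (ball 0 1)) {ρ : ℝ} (hρ : ρ ∈ Ioo (0 : ℝ) 1) :
    InnerProductSpace.HarmonicOnNhd (fun z : ℂ => w (ρ * z)) (closedBall 0 1) := by
  have h1 := (harmonicOnNhd_dilate_real (hw.comp_CLM Complex.reCLM) hρ).comp_CLM Complex.ofRealCLM
  have h2 := (harmonicOnNhd_dilate_real (hw.comp_CLM Complex.imCLM) hρ).comp_CLM
    (Complex.I • Complex.ofRealCLM)
  convert h1.add h2 using 1
  ext z
  simp [mul_comm Complex.I, Complex.re_add_im]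

lemma MemHardy.differentiableAt {F : Type*} [NormedAddCommGroup F] [NormedSpace ℝ F]
    {p : ℝ≥0∞} {w : ℂ → F} (hw : MemHardy p w) {z : ℂ}
    (hz : z ∈ ball (0 : ℂ) 1) : DifferentiableAt ℝ w z :=
  (hw.1 z hz).1.differentiableAt (by norm_num)

/-- No boundary values of `w` are needed: Poisson's formula is applied to `w(ρ ·)`, whose `L^p` norm
on the circle is at most the Hardy norm and whose differential at `z` is `ρ Dw(ρ z)`. Continuity of
`Dw` allows `ρ → 1`. -/
lemma norm_fderiv_apply_le_kernelNorm {p : ℝ≥0∞} {q : ℝ} (hq : 1 ≤ q)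
    (hpq : ENNReal.HolderConjugate p (ENNReal.ofReal q)) {w : ℂ → ℂ} (hw : MemHardy p w) {z : ℂ}
    (hz : z ∈ ball (0 : ℂ) 1) (l : ℂ) :
    ‖fderiv ℝ w z l‖ ≤ kernelNorm q z l * (hardyNorm p w).toReal := by
  have hz' : ‖z‖ < 1 := by simpa using hz
  have hfin : ENNReal.ofReal (hardyNorm p w).toReal = hardyNorm p w :=
    ENNReal.ofReal_toReal hw.2.ne
  have hmem : ∀ ρ ∈ Ioo (0 : ℝ) 1, (ρ : ℂ) * z ∈ ball (0 : ℂ) 1 := by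
    intro ρ hρ
    simp only [mem_ball_zero_iff, norm_mul, Complex.norm_real, Real.norm_eq_abs, abs_of_pos hρ.1]
    nlinarith [hρ.1, hρ.2, norm_nonneg z]
  have key : ∀ ρ ∈ Ioo (0 : ℝ) 1, ‖ρ • fderiv ℝ w (ρ * z) l‖ ≤
      kernelNorm q z l * (hardyNorm p w).toReal := by
    intro ρ hρ
    have hd := harmonicOnNhd_dilate hw.1 hρ
    have h1 := fderiv_complex_harmonic hd hz l
    have hsc : HasFDerivAt (fun z : ℂ => (ρ : ℂ) * z) (ρ • ContinuousLinearMap.id ℝ ℂ) z := by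
      have : (fun z : ℂ => (ρ : ℂ) * z) = fun z => (ρ • ContinuousLinearMap.id ℝ ℂ) z := by
        ext z; simp
      rw [this]
      exact ContinuousLinearMap.hasFDerivAt _
    have h2 := ((hw.differentiableAt (hmem ρ hρ)).hasFDerivAt.comp z hsc).fderiv
    have h3 : fderiv ℝ (fun z : ℂ => w (ρ * z)) z l = ρ • fderiv ℝ w (ρ * z) l := by
      change fderiv ℝ (w ∘ fun z : ℂ => (ρ : ℂ) * z) z l = _
      rw [h2]; simp
    rw [← h3, h1, norm_mul, kernelNorm, mul_assoc]
    have hpi : ‖(1 / π : ℂ)‖ = 1 / π := by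
      rw [← Complex.ofReal_one, ← Complex.ofReal_div, Complex.norm_real, Real.norm_eq_abs,
        abs_of_pos (by positivity)]
    rw [hpi]
    refine mul_le_mul_of_nonneg_left ?_ (by positivity)
    refine norm_integral_smul_le hq hpq (continuous_gradKernel hz l)
      (hd.continuousOn.comp_continuous continuous_circ (fun t => by simp)) ENNReal.toReal_nonneg ?_
    rw [hfin]
    exact le_iSup₂ (f := fun ρ (_ : ρ ∈ Ioo (0 : ℝ) 1) =>
      eLpNorm (fun θ : ℝ => w (ρ * Complex.exp (θ * Complex.I))) p
      (volume.restrict (Ioc (-Real.pi) Real.pi))) ρ hρ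
  have hcd : ContinuousAt (fderiv ℝ w) z :=
    ((hw.1 z hz).1.fderiv_right (m := 1) (by norm_num)).continuousAt
  have hlim : Tendsto (fun ρ : ℝ => ‖ρ • fderiv ℝ w (ρ * z) l‖) (𝓝[<] 1)
      (𝓝 ‖(1 : ℝ) • fderiv ℝ w z l‖) := by
    refine Tendsto.norm (Tendsto.smul (tendsto_id.mono_left nhdsWithin_le_nhds) ?_)
    have h1 : Tendsto (fun ρ : ℝ => (ρ : ℂ) * z) (𝓝[<] 1) (𝓝 z) := by
      have : Continuous (fun ρ : ℝ => (ρ : ℂ) * z) := by fun_prop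
      have h := this.tendsto 1
      simp only [Complex.ofReal_one, one_mul] at h
      exact h.mono_left nhdsWithin_le_nhds
    have h2 := hcd.tendsto.comp h1
    exact ((ContinuousLinearMap.apply ℝ ℂ l).continuous.tendsto _).comp h2
  rw [one_smul] at hlim
  refine le_of_tendsto hlim ?_
  filter_upwards [Ioo_mem_nhdsLT (show (0 : ℝ) < 1 by norm_num)] with ρ hρ using key ρ hρ

/-! ### Poisson integrals and extremal functions -/

/-- The Poisson kernel of the circle of radius `ρ`, as a probability density in the angle. -/
def poissonDensity (ρ x : ℝ) : ℝ := (2 * π)⁻¹ * ((1 - ρ ^ 2) / sqDist ρ x)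

lemma poissonDensity_neg (ρ x : ℝ) : poissonDensity ρ (-x) = poissonDensity ρ x := by
  simp [poissonDensity, sqDist]

lemma poissonDensity_pos {ρ : ℝ} (hρ : ρ ∈ Ioo (0 : ℝ) 1) (x : ℝ) : 0 < poissonDensity ρ x := by
  have h1 := sqDist_pos hρ.1.le hρ.2 x
  have h2 : 0 < 1 - ρ ^ 2 := by nlinarith [hρ.1, hρ.2]
  have := pi_pos
  unfold poissonDensity
  positivity

lemma continuous_poissonDensity {ρ : ℝ} (hρ : ρ ∈ Ioo (0 : ℝ) 1) :
    Continuous (poissonDensity ρ) := by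
  have : Continuous (sqDist ρ) := by unfold sqDist; fun_prop
  exact (continuous_const.div this fun x => (sqDist_pos hρ.1.le hρ.2 x).ne').const_mul _

lemma mul_circ_mem_ball {ρ : ℝ} (hρ : ρ ∈ Ioo (0 : ℝ) 1) (θ : ℝ) :
    (ρ : ℂ) * circ θ ∈ ball (0 : ℂ) 1 := by
  simp [abs_of_pos hρ.1, hρ.2]

lemma re_herglotz_mul_circ {φ : ℝ → ℝ} (hφ : IntervalIntegrable φ volume (-π) π) {ρ : ℝ}
    (hρ : ρ ∈ Ioo (0 : ℝ) 1) (θ : ℝ) :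
    (herglotz φ (ρ * circ θ)).re = ∫ t in (-π)..π, poissonDensity ρ (t - θ) * φ t := by
  rw [re_herglotz_eq hφ (mul_circ_mem_ball hρ θ), ← intervalIntegral.integral_const_mul]
  refine intervalIntegral.integral_congr fun t _ => ?_
  have h1 := congrFun (poissonKernel_eq_re_herglotzRieszKernel (c := 0) (w := ρ * circ θ)) (circ t)
  have h2 : ‖circ t - ρ * circ θ‖ ^ 2 = sqDist ρ (t - θ) := by
    have e : circ t - ρ * circ θ = circ θ * (circ (t - θ) - ρ) := by
      rw [mul_sub, ← circ_add]; ring_nf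
    rw [e, norm_mul, norm_circ, one_mul, ← Complex.normSq_eq_norm_sq, Complex.normSq_apply]
    simp only [Complex.sub_re, Complex.sub_im, re_circ, im_circ, Complex.ofReal_re,
      Complex.ofReal_im, sqDist]
    nlinarith [Real.sin_sq_add_cos_sq (t - θ)]
  simp only [poissonKernel_def, Function.comp, herglotzRieszKernel_def, sub_zero, h2, norm_circ,
    norm_mul, Complex.norm_real, Real.norm_eq_abs, mul_one, sq_abs, one_pow] at h1
  simp only [← h1, poissonDensity]
  ring

lemma lintegral_poissonDensity {ρ : ℝ} (hρ : ρ ∈ Ioo (0 : ℝ) 1) (θ : ℝ) :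
    ∫⁻ t in Ioc (-π) π, ENNReal.ofReal (poissonDensity ρ (t - θ)) = 1 := by
  have hc : Continuous fun t => poissonDensity ρ (t - θ) :=
    (continuous_poissonDensity hρ).comp (by fun_prop)
  have h1 : ∫ t in (-π)..π, poissonDensity ρ (t - θ) = 1 := by
    have h := re_herglotz_mul_circ (φ := fun _ => 1) intervalIntegrable_const hρ θ
    simp only [mul_one] at h
    rw [← h]
    exact re_herglotz_of_harmonic (u := fun _ => 1)
      (InnerProductSpace.harmonicOnNhd_const 1) (mul_circ_mem_ball hρ θ)
  rw [← ofReal_integral_eq_lintegral_ofReal, ← intervalIntegral.integral_of_le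
    (by linarith [pi_pos]), h1, ENNReal.ofReal_one]
  · exact (hc.intervalIntegrable (-π) π).1
  · exact Eventually.of_forall fun t => (poissonDensity_pos hρ _).le

/-- The Poisson integral does not increase `L^p` norms. -/
lemma hardyNorm_re_herglotz_le {p : ℝ≥0∞} (hp : 1 ≤ p) {φ : ℝ → ℝ} (hφm : Measurable φ)
    (hφ : IntervalIntegrable φ volume (-π) π) :
    hardyNorm p (fun z => (herglotz φ z).re) ≤ eLpNorm φ p (volume.restrict (Ioc (-π) π)) := by
  refine iSup₂_le fun ρ hρ => ?_
  set μ := volume.restrict (Ioc (-π) π) with hμ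
  change eLpNorm (fun θ : ℝ => (herglotz φ (ρ * circ θ)).re) p μ ≤ _
  have hpd := continuous_poissonDensity hρ
  have hmeas : ∀ θ, Measurable fun t => ENNReal.ofReal (poissonDensity ρ (t - θ)) := fun θ =>
    (hpd.comp (by fun_prop : Continuous fun t : ℝ => t - θ)).measurable.ennreal_ofReal
  set ν : ℝ → Measure ℝ := fun θ =>
    μ.withDensity fun t => ENNReal.ofReal (poissonDensity ρ (t - θ)) with hν
  have hprob : ∀ θ, IsProbabilityMeasure (ν θ) := fun θ =>
    ⟨by rw [hν]; simp only [withDensity_apply _ MeasurableSet.univ, Measure.restrict_univ];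
        exact lintegral_poissonDensity hρ θ⟩
  -- The value at `ρ e^{iθ}` is the mean of `φ` for the probability measure `ν θ`, where the `L¹`
  -- norm is at most the `L^p` norm.
  have hle : ∀ θ, ‖(herglotz φ (ρ * circ θ)).re‖ₑ ≤ eLpNorm φ p (ν θ) := by
    intro θ
    have := hprob θ
    refine le_trans ?_ (eLpNorm_le_eLpNorm_of_exponent_le hp hφm.aestronglyMeasurable)
    rw [eLpNorm_one_eq_lintegral_enorm, hν,
      lintegral_withDensity_eq_lintegral_mul₀ (hmeas θ).aemeasurable hφm.enorm.aemeasurable,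
      re_herglotz_mul_circ hφ hρ, intervalIntegral.integral_of_le (by linarith [pi_pos])]
    refine (enorm_integral_le_lintegral_enorm _).trans (le_of_eq (lintegral_congr fun t => ?_))
    rw [enorm_mul, Real.enorm_of_nonneg (poissonDensity_pos hρ _).le, Pi.mul_apply]
  rcases eq_or_ne p ∞ with rfl | hpt
  · simp only [eLpNorm_exponent_top] at hle ⊢
    exact eLpNormEssSup_le_of_ae_enorm_bound (Eventually.of_forall fun θ =>
      (hle θ).trans (eLpNormEssSup_mono_measure _ (withDensity_absolutelyContinuous _ _)))
  · have hp0 : p ≠ 0 := (zero_lt_one.trans_le hp).ne'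
    have hr : 0 < p.toReal := ENNReal.toReal_pos hp0 hpt
    rw [eLpNorm_eq_lintegral_rpow_enorm_toReal hp0 hpt,
      eLpNorm_eq_lintegral_rpow_enorm_toReal hp0 hpt]
    refine ENNReal.rpow_le_rpow ?_ (by positivity)
    have hle' : ∀ θ, ‖(herglotz φ (ρ * circ θ)).re‖ₑ ^ p.toReal ≤
        ∫⁻ t, ENNReal.ofReal (poissonDensity ρ (t - θ)) * ‖φ t‖ₑ ^ p.toReal ∂μ := by
      intro θ
      refine (ENNReal.rpow_le_rpow (hle θ) hr.le).trans (le_of_eq ?_)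
      rw [eLpNorm_eq_lintegral_rpow_enorm_toReal hp0 hpt, ← ENNReal.rpow_mul,
        one_div_mul_cancel hr.ne', ENNReal.rpow_one, hν,
        lintegral_withDensity_eq_lintegral_mul₀ (hmeas θ).aemeasurable
          (hφm.enorm.pow_const _).aemeasurable]
      rfl
    refine (lintegral_mono hle').trans (le_of_eq ?_)
    rw [lintegral_lintegral_swap]
    · refine lintegral_congr fun t => ?_
      rw [lintegral_mul_const _ ?_]
      -- The density is symmetric in `t` and `θ`, so after Fubini its integral in `θ` is also `1`.
      · have : ∀ θ, poissonDensity ρ (t - θ) = poissonDensity ρ (θ - t) := fun θ => by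
          rw [← poissonDensity_neg, neg_sub]
        simp only [this]
        rw [hμ, lintegral_poissonDensity hρ t, one_mul]
      · exact (hpd.comp (by fun_prop : Continuous fun θ : ℝ => t - θ)).measurable.ennreal_ofReal
    · refine Measurable.aemeasurable ?_
      refine Measurable.mul ?_ ((hφm.comp measurable_snd).enorm.pow_const _)
      exact (hpd.comp
        (by fun_prop : Continuous fun x : ℝ × ℝ => x.2 - x.1)).measurable.ennreal_ofReal

lemma continuous_dirIntegrand {q : ℝ} (hq : 1 ≤ q) (r τ : ℝ) :
    Continuous fun s => |Real.cos (s + τ)| ^ q * sqDist r s ^ (q - 1) := by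
  have : Continuous (sqDist r) := by unfold sqDist; fun_prop
  refine Continuous.mul (Continuous.rpow_const (by fun_prop) fun s => Or.inr (by linarith)) ?_
  exact this.rpow_const fun s => Or.inr (by linarith)

lemma dirIntegral_pos {q : ℝ} (hq : 1 ≤ q) {r : ℝ} (hr : 0 ≤ r) (hr1 : r < 1) (τ : ℝ) :
    0 < dirIntegral q r τ := by
  have hpi := pi_pos
  refine intervalIntegral.integral_pos (by linarith)
    (continuous_dirIntegrand hq r τ).continuousOn (fun s _ => ?_) ?_
  · have := sqDist_nonneg r s; positivity
  · have key : ∀ c, Real.cos (c + τ) ≠ 0 →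
        0 < |Real.cos (c + τ)| ^ q * sqDist r c ^ (q - 1) := fun c hc => by
      have := sqDist_pos hr hr1 c
      positivity
    by_cases h : Real.cos τ = 0
    · refine ⟨π / 2, ⟨by linarith, by linarith⟩, key _ ?_⟩
      rw [add_comm, Real.cos_add_pi_div_two]
      intro h'
      have := Real.sin_sq_add_cos_sq τ
      rw [h, neg_eq_zero.1 h'] at this
      norm_num at this
    · exact ⟨0, ⟨by linarith, by linarith⟩, key _ (by simpa using h)⟩

/-- An extremal function for the directional derivative at a point of the disk. -/
lemma exists_extremal {p : ℝ≥0∞} {q : ℝ} (hp : 1 ≤ p) (hq : 1 ≤ q)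
    (hpq : (1 / p).toReal = 1 - 1 / q) {z : ℂ} (hz : z ∈ ball (0 : ℂ) 1) (l : ℂ) :
    ∃ u : ℂ → ℝ, MemHardy p u ∧
      fderiv ℝ u z l = 1 / π * ∫ t in (-π)..π, |gradKernel z l t| ^ q ∧
      (hardyNorm p u).toReal ≤ (∫ t in (-π)..π, |gradKernel z l t| ^ q) ^ (1 - 1 / q) := by
  have hpi : -π ≤ π := by linarith [pi_pos]
  set K := gradKernel z l with hK
  have hKc : Continuous K := continuous_gradKernel hz l
  have hKr : Continuous fun t => |K t| ^ (q - 1) :=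
    hKc.abs.rpow_const fun t => Or.inr (by linarith)
  -- The equality case of Hölder: `φ = |K|^{q-1} sign K`, so that `K φ = |K|^q` and, for finite `p`,
  -- `|φ|^p = |K|^q` because `(q - 1) p = q`. When `q = 1` this is a function with values `±1`.
  set φ : ℝ → ℝ := fun t => if 0 ≤ K t then |K t| ^ (q - 1) else -|K t| ^ (q - 1) with hφdef
  have hφm : Measurable φ :=
    Measurable.ite (measurableSet_le measurable_const hKc.measurable) hKr.measurable
      hKr.measurable.neg
  have hφabs : ∀ t, ‖φ t‖ = |K t| ^ (q - 1) := fun t => by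
    have h0 : 0 ≤ |K t| ^ (q - 1) := by positivity
    simp only [hφdef]
    split_ifs <;> simp [abs_of_nonneg h0]
  have hKφ : ∀ t, K t * φ t = |K t| ^ q := fun t => by
    have h1 : |K t| * |K t| ^ (q - 1) = |K t| ^ q := by
      rcases eq_or_ne (K t) 0 with h | h
      · rw [h, abs_zero, zero_mul, Real.zero_rpow (by linarith)]
      · rw [Real.rpow_sub_one (abs_ne_zero.2 h)]
        field_simp
    rw [← h1]
    simp only [hφdef]
    split_ifs with h
    · rw [abs_of_nonneg h]
    · rw [abs_of_neg (not_le.1 h)]; ring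
  have hφi : IntervalIntegrable φ volume (-π) π :=
    (hKr.intervalIntegrable _ _).mono_fun hφm.aestronglyMeasurable
      (Eventually.of_forall fun t => by
        beta_reduce
        rw [hφabs]
        exact le_abs_self _)
  set N := ∫ t in (-π)..π, |K t| ^ q with hN
  have hN0 : 0 ≤ N := intervalIntegral.integral_nonneg hpi fun s _ => by positivity
  have hnorm : eLpNorm φ p (volume.restrict (Ioc (-π) π)) ≤ ENNReal.ofReal (N ^ (1 - 1 / q)) := by
    rcases eq_or_ne p ∞ with rfl | hpt
    · have hq1 : q = 1 := by
        simp only [one_div, ENNReal.inv_top, ENNReal.toReal_zero] at hpq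
        have : q⁻¹ = 1 := by linarith
        simpa using this
      subst hq1
      simp only [eLpNorm_exponent_top]
      refine eLpNormEssSup_le_of_ae_enorm_bound (Eventually.of_forall fun t => ?_)
      rw [← ofReal_norm, hφabs]
      simp
    · have hp0 : p ≠ 0 := (zero_lt_one.trans_le hp).ne'
      have hr : 0 < p.toReal := ENNReal.toReal_pos hp0 hpt
      have hpr : 1 / p.toReal = 1 - 1 / q := by
        rw [← hpq, one_div, one_div, ENNReal.toReal_inv]
      have hexp : (q - 1) * p.toReal = q := by
        have hq0 : q ≠ 0 := by linarith
        field_simp at hpr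
        linarith
      rw [eLpNorm_eq_lintegral_rpow_enorm_toReal hp0 hpt, hpr,
        ← ENNReal.ofReal_rpow_of_nonneg hN0 (by rw [← hpr]; positivity)]
      refine le_of_eq ?_
      congr 1
      rw [hN, intervalIntegral.integral_of_le hpi, ofReal_integral_eq_lintegral_ofReal]
      · refine lintegral_congr fun t => ?_
        rw [← ofReal_norm, hφabs, ENNReal.ofReal_rpow_of_nonneg (by positivity) hr.le,
          ← Real.rpow_mul (abs_nonneg _), hexp]
      · exact ((hKc.abs.rpow_const fun t => Or.inr (by linarith)).intervalIntegrable (-π) π).1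
      · exact Eventually.of_forall fun t => by positivity
  have hle := (hardyNorm_re_herglotz_le hp hφm hφi).trans hnorm
  refine ⟨fun z => (herglotz φ z).re, ⟨harmonicOnNhd_re_herglotz hφi,
    hle.trans_lt ENNReal.ofReal_lt_top⟩, ?_, ?_⟩
  · rw [fderiv_re_herglotz hφi hz]
    simp only [← hK, hKφ, hN]
  · exact (ENNReal.toReal_mono ENNReal.ofReal_ne_top hle).trans_eq
      (ENNReal.toReal_ofReal (by positivity))

/-- The extremal function shows that the directional constant is best possible. -/
lemma exists_dirConst_le {p : ℝ≥0∞} {q : ℝ} (hp : 1 ≤ p) (hq : 1 ≤ q)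
    (hpq : (1 / p).toReal = 1 - 1 / q) {z : ℂ} (hz : z ∈ ball (0 : ℂ) 1) (τ : ℝ) :
    ∃ u : ℂ → ℝ, MemHardy p u ∧ ∀ C : ℝ,
      ‖fderiv ℝ u z (circ τ)‖ ≤ C * weight p z * (hardyNorm p u).toReal →
        dirConst q z (circ τ) ≤ C := by
  obtain ⟨u, hu, hd, hn⟩ := exists_extremal hp hq hpq hz (circ τ)
  refine ⟨u, hu, fun C hC => ?_⟩
  have hz' : ‖z‖ < 1 := by simpa using hz
  have hW : 0 < 1 - ‖z‖ ^ 2 := by nlinarith [norm_nonneg z]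
  have hk := kernelNorm_eq hq hpq hz τ
  have hNpos : 0 < ∫ t in (-π)..π, |gradKernel z (circ τ) t| ^ q := by
    rw [integral_abs_gradKernel_rpow (by linarith) hz]
    exact mul_pos (Real.rpow_pos_of_pos hW _) (dirIntegral_pos hq (norm_nonneg z) hz' _)
  rw [kernelNorm] at hk
  rw [hd] at hC
  generalize (∫ t in (-π)..π, |gradKernel z (circ τ) t| ^ q) = N at *
  have hpi := pi_pos
  rw [Real.norm_eq_abs, abs_of_pos (by positivity)] at hC
  have hw := weight_pos p hz
  -- The derivative of the extremal function is positive, which rules out `C ≤ 0`; this sign is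
  -- needed to insert the upper bound for the Hardy norm.
  have hCw : 0 < C * weight p z := by
    by_contra h
    have : C * weight p z * (hardyNorm p u).toReal ≤ 0 :=
      mul_nonpos_of_nonpos_of_nonneg (not_lt.1 h) ENNReal.toReal_nonneg
    have : 0 < 1 / π * N := by positivity
    linarith
  have h1 : 1 / π * N ≤ C * weight p z * N ^ (1 - 1 / q) :=
    hC.trans (mul_le_mul_of_nonneg_left hn hCw.le)
  have h2 : N = N ^ (1 / q) * N ^ (1 - 1 / q) := by
    rw [← Real.rpow_add hNpos]; simp
  nth_rw 1 [h2] at h1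
  rw [← mul_assoc] at h1
  have h3 := le_of_mul_le_mul_right h1 (by positivity)
  rw [hk] at h3
  exact le_of_mul_le_mul_right h3 hw

/-! ### Extremal directions by rearrangement -/

/-- Even periodic functions that are similarly ordered correlate best without a shift. -/
lemma integral_shift_mul_le {φ H : ℝ → ℝ} (hφ : Continuous φ) (hH : Continuous H)
    (hφp : Function.Periodic φ (2 * π)) (hHp : Function.Periodic H (2 * π))
    (hφe : ∀ s, φ (-s) = φ s) (hHe : ∀ s, H (-s) = H s)
    (hord : ∀ s t, 0 ≤ (φ s - φ t) * (H s - H t)) (τ : ℝ) :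
    ∫ s in (-π)..π, φ (s + τ) * H s ≤ ∫ s in (-π)..π, φ s * H s := by
  have hpi : -π ≤ π := by linarith [pi_pos]
  have hshift : ∀ g : ℝ → ℝ, Function.Periodic g (2 * π) → ∀ c,
      ∫ s in (-π)..π, g (s + c) = ∫ s in (-π)..π, g s := by
    intro g hg c
    rw [intervalIntegral.integral_comp_add_right, show π + c = (-π + c) + 2 * π by ring,
      hg.intervalIntegral_add_eq _ (-π)]
    congr 1; ring
  -- Shifting by `-τ` and reflecting `s ↦ -s` identifies the two cross terms, thanks to evenness.
  have h1 : ∫ s in (-π)..π, φ s * H (s + τ) = ∫ s in (-π)..π, φ (s + τ) * H s := by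
    rw [← hshift (fun s => φ s * H (s + τ)) (fun s => by
      simp only [hφp s, show s + 2 * π + τ = s + τ + 2 * π by ring, hHp (s + τ)]) (-τ)]
    have := intervalIntegral.integral_comp_neg (a := -π) (b := π) (fun s => φ (s + τ) * H s)
    rw [neg_neg] at this
    rw [← this]
    refine intervalIntegral.integral_congr fun s _ => ?_
    simp only [hHe]
    rw [← hφe (s + -τ), show s + -τ + τ = s by ring, show -(s + -τ) = -s + τ by ring]
  have h2 : ∫ s in (-π)..π, φ (s + τ) * H (s + τ) = ∫ s in (-π)..π, φ s * H s :=
    hshift (fun s => φ s * H s) (fun s => by simp only [hφp s, hHp s]) τ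
  -- Chebyshev's trick: expanding this nonnegative integral gives twice the desired difference.
  have h3 : 0 ≤ ∫ s in (-π)..π, (φ s - φ (s + τ)) * (H s - H (s + τ)) :=
    intervalIntegral.integral_nonneg hpi fun s _ => hord _ _
  have h4 : ∫ s in (-π)..π, (φ s - φ (s + τ)) * (H s - H (s + τ)) =
      ((∫ s in (-π)..π, φ s * H s) - ∫ s in (-π)..π, φ s * H (s + τ)) -
      ((∫ s in (-π)..π, φ (s + τ) * H s) - ∫ s in (-π)..π, φ (s + τ) * H (s + τ)) := by
    have hi : ∀ {g : ℝ → ℝ}, Continuous g → IntervalIntegrable g volume (-π) π :=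
      fun hg => hg.intervalIntegrable _ _
    rw [← intervalIntegral.integral_sub (hi (by fun_prop)) (hi (by fun_prop)),
      ← intervalIntegral.integral_sub (hi (by fun_prop)) (hi (by fun_prop)),
      ← intervalIntegral.integral_sub (hi (by fun_prop)) (hi (by fun_prop))]
    refine intervalIntegral.integral_congr fun s _ => ?_
    ring
  rw [h1, h2] at h4
  linarith

/-- Both `A - x` and `A + x` are convex combinations of `A - y` and `A + y`, with the weights `(y ±
x)/(2y)` interchanged; adding the two convexity inequalities gives the claim. -/
lemma ConvexOn.symm_add_le {g : ℝ → ℝ} {S : Set ℝ} (hg : ConvexOn ℝ S g) {A x y : ℝ} (hx : 0 ≤ x)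
    (hxy : x ≤ y) (h1 : A - y ∈ S) (h2 : A + y ∈ S) :
    g (A - x) + g (A + x) ≤ g (A - y) + g (A + y) := by
  rcases eq_or_lt_of_le (hx.trans hxy) with hy | hy
  · rw [show x = y by linarith]
  · have ha : 0 ≤ (y + x) / (2 * y) := by positivity
    have hb : 0 ≤ (y - x) / (2 * y) := div_nonneg (by linarith) (by linarith)
    have hab : (y + x) / (2 * y) + (y - x) / (2 * y) = 1 := by field_simp; ring
    have e1 := hg.2 h1 h2 ha hb hab
    have e2 := hg.2 h1 h2 hb ha (by linarith)
    simp only [smul_eq_mul] at e1 e2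
    rw [show (y + x) / (2 * y) * (A - y) + (y - x) / (2 * y) * (A + y) = A - x by
      field_simp; ring] at e1
    rw [show (y - x) / (2 * y) * (A - y) + (y + x) / (2 * y) * (A + y) = A + x by
      field_simp; ring] at e2
    have : (y + x) / (2 * y) = 1 - (y - x) / (2 * y) := by linarith
    rw [this] at e1 e2
    linarith

/-- The weight `|1 - r e^{is}|^{2a}` symmetrized under `s ↦ s + π`. -/
def foldedWeight (r a s : ℝ) : ℝ := sqDist r s ^ a + sqDist r (s + π) ^ a

lemma foldedWeight_eq {r : ℝ} (a s : ℝ) :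
    foldedWeight r a s =
      (1 + r ^ 2 - 2 * r * |Real.cos s|) ^ a + (1 + r ^ 2 + 2 * r * |Real.cos s|) ^ a := by
  rw [foldedWeight, sqDist, sqDist, Real.cos_add_pi]
  rcases le_total 0 (Real.cos s) with h | h
  · rw [abs_of_nonneg h]; ring_nf
  · rw [abs_of_nonpos h]; ring_nf

lemma continuous_foldedWeight (r : ℝ) {a : ℝ} (ha : 0 ≤ a) : Continuous (foldedWeight r a) := by
  have h : Continuous (sqDist r) := by unfold sqDist; fun_prop
  exact (h.rpow_const fun s => Or.inr ha).add
    ((h.comp (continuous_add_const π)).rpow_const fun s => Or.inr ha)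

lemma one_add_sq_sub_nonneg {r c : ℝ} (hr : 0 ≤ r) (hc : c ≤ 1) :
    0 ≤ 1 + r ^ 2 - 2 * r * c := by
  nlinarith [sq_nonneg (1 - r), mul_nonneg hr (sub_nonneg.2 hc)]

lemma foldedWeight_mono {r a : ℝ} (hr : 0 ≤ r) (ha : 1 ≤ a) {s t : ℝ}
    (hst : |Real.cos s| ≤ |Real.cos t|) : foldedWeight r a s ≤ foldedWeight r a t := by
  rw [foldedWeight_eq, foldedWeight_eq]
  have h := one_add_sq_sub_nonneg hr (Real.abs_cos_le_one t)
  exact ConvexOn.symm_add_le (convexOn_rpow ha) (by positivity) (by gcongr) h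
    (by simp only [mem_Ici]; positivity)

lemma foldedWeight_anti {r a : ℝ} (hr : 0 ≤ r) (ha : 0 ≤ a) (ha1 : a ≤ 1) {s t : ℝ}
    (hst : |Real.cos s| ≤ |Real.cos t|) : foldedWeight r a t ≤ foldedWeight r a s := by
  rw [foldedWeight_eq, foldedWeight_eq]
  have h := one_add_sq_sub_nonneg hr (Real.abs_cos_le_one t)
  have := ConvexOn.symm_add_le (Real.concaveOn_rpow ha ha1).neg
    (x := 2 * r * |Real.cos s|) (y := 2 * r * |Real.cos t|) (A := 1 + r ^ 2)
    (by positivity) (by gcongr) h (by simp only [mem_Ici]; positivity)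
  simp only [Pi.neg_apply] at this
  linarith

/-- Since `|cos|^q` has period `π`, the integral is unchanged when the weight is averaged with its
translate by `π`. The sign of `cos s` then no longer matters in the weight. -/
lemma dirIntegral_eq_folded {q : ℝ} (hq : 1 ≤ q) (r τ : ℝ) :
    dirIntegral q r τ =
      1 / 2 * ∫ s in (-π)..π, |Real.cos (s + τ)| ^ q * foldedWeight r (q - 1) s := by
  set g : ℝ → ℝ := fun s => |Real.cos (s + τ)| ^ q * sqDist r s ^ (q - 1) with hg
  have hgc : Continuous g := continuous_dirIntegrand hq r τ
  have hper : Function.Periodic g (2 * π) := fun s => by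
    simp only [hg, sqDist, Real.cos_add_two_pi]
    rw [show s + 2 * π + τ = s + τ + 2 * π by ring, Real.cos_add_two_pi]
  have h1 : ∫ s in (-π)..π, g (s + π) = ∫ s in (-π)..π, g s := by
    rw [intervalIntegral.integral_comp_add_right, show π + π = (-π + π) + 2 * π by ring,
      hper.intervalIntegral_add_eq _ (-π)]
    congr 1; ring
  have h2 : ∫ s in (-π)..π, |Real.cos (s + τ)| ^ q * foldedWeight r (q - 1) s =
      (∫ s in (-π)..π, g s) + ∫ s in (-π)..π, g (s + π) := by
    have hgc' : Continuous fun s => g (s + π) := hgc.comp (continuous_add_const π)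
    rw [← intervalIntegral.integral_add (hgc.intervalIntegrable _ _)
      (hgc'.intervalIntegrable _ _)]
    refine intervalIntegral.integral_congr fun s _ => ?_
    simp only [hg, foldedWeight]
    rw [show s + π + τ = s + τ + π by ring, Real.cos_add_pi, abs_neg]
    ring
  rw [h2, h1, dirIntegral]
  ring

lemma abs_sin_le_of_abs_cos_le {s t : ℝ} (h : |Real.cos s| ≤ |Real.cos t|) :
    |Real.sin t| ≤ |Real.sin s| := by
  rw [← sq_le_sq] at h ⊢
  nlinarith [Real.sin_sq_add_cos_sq s, Real.sin_sq_add_cos_sq t]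

lemma foldedWeight_periodic (r a : ℝ) : Function.Periodic (foldedWeight r a) (2 * π) :=
  fun s => by simp only [foldedWeight_eq, Real.cos_add_two_pi]

lemma foldedWeight_neg (r a s : ℝ) : foldedWeight r a (-s) = foldedWeight r a s := by
  simp only [foldedWeight_eq, Real.cos_neg]

/-- If the folded weight is ordered by `ε |cos|`, the integral is extremal at the angles
`0` and `π / 2`. -/
lemma dirIntegral_extremal {q r : ℝ} (hq : 1 ≤ q) {ε : ℝ}
    (hord : ∀ s t, |Real.cos s| ≤ |Real.cos t| →
      ε * foldedWeight r (q - 1) s ≤ ε * foldedWeight r (q - 1) t) (τ : ℝ) :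
    ε * dirIntegral q r (π / 2) ≤ ε * dirIntegral q r τ ∧
      ε * dirIntegral q r τ ≤ ε * dirIntegral q r 0 := by
  have hHc := continuous_foldedWeight r (show 0 ≤ q - 1 by linarith)
  have hcc : Continuous fun s => |Real.cos s| ^ q :=
    Continuous.rpow_const (by fun_prop) fun s => Or.inr (by linarith)
  have hsc : Continuous fun s => |Real.sin s| ^ q :=
    Continuous.rpow_const (by fun_prop) fun s => Or.inr (by linarith)
  have hq0 : 0 ≤ q := by linarith
  have hpull : ∀ g : ℝ → ℝ, ∫ s in (-π)..π, g s * (ε * foldedWeight r (q - 1) s) =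
      ε * ∫ s in (-π)..π, g s * foldedWeight r (q - 1) s := fun g => by
    rw [← intervalIntegral.integral_const_mul]
    exact intervalIntegral.integral_congr fun s _ => by ring
  have hpull' : ∀ g : ℝ → ℝ, ∫ s in (-π)..π, g s * (-(ε * foldedWeight r (q - 1) s)) =
      -(ε * ∫ s in (-π)..π, g s * foldedWeight r (q - 1) s) := fun g => by
    rw [← intervalIntegral.integral_const_mul, ← intervalIntegral.integral_neg]
    exact intervalIntegral.integral_congr fun s _ => by ring
  constructor
  -- For the lower end, `|sin|` is ordered oppositely to `|cos|`, hence similarly to minus the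
  -- weight; `|cos(s + τ)|` is `|sin|` shifted by `τ - π/2`.
  · have h := integral_shift_mul_le (φ := fun s => |Real.sin s| ^ q)
      (H := fun s => -(ε * foldedWeight r (q - 1) s)) hsc (by fun_prop)
      (fun s => by simp only [Real.sin_add_two_pi])
      (fun s => by simp only [foldedWeight_periodic r (q - 1) s])
      (fun s => by simp only [Real.sin_neg, abs_neg])
      (fun s => by simp only [foldedWeight_neg]) ?_ (τ - π / 2)
    · rw [hpull' fun s => |Real.sin (s + (τ - π / 2))| ^ q, hpull'] at h
      rw [dirIntegral_eq_folded hq, dirIntegral_eq_folded hq]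
      simp only [Real.cos_add_pi_div_two, abs_neg]
      have : ∀ s, |Real.sin (s + (τ - π / 2))| = |Real.cos (s + τ)| := fun s => by
        rw [← add_sub_assoc, Real.sin_sub_pi_div_two, abs_neg]
      simp only [this] at h
      linarith
    · intro s t
      rcases le_total |Real.cos s| |Real.cos t| with hc | hc
      · have h1 := hord s t hc
        have h2 := Real.rpow_le_rpow (abs_nonneg _) (abs_sin_le_of_abs_cos_le hc) hq0
        exact mul_nonneg (by linarith) (by linarith)
      · have h1 := hord t s hc
        have h2 := Real.rpow_le_rpow (abs_nonneg _) (abs_sin_le_of_abs_cos_le hc) hq0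
        exact mul_nonneg_of_nonpos_of_nonpos (by linarith) (by linarith)
  · have h := integral_shift_mul_le (φ := fun s => |Real.cos s| ^ q)
      (H := fun s => ε * foldedWeight r (q - 1) s) hcc (by fun_prop)
      (fun s => by simp only [Real.cos_add_two_pi])
      (fun s => by simp only [foldedWeight_periodic r (q - 1) s])
      (fun s => by simp only [Real.cos_neg])
      (fun s => by simp only [foldedWeight_neg]) ?_ τ
    · rw [hpull fun s => |Real.cos (s + τ)| ^ q, hpull] at h
      rw [dirIntegral_eq_folded hq, dirIntegral_eq_folded hq]
      simp only [add_zero]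
      linarith
    · intro s t
      rcases le_total |Real.cos s| |Real.cos t| with hc | hc
      · have h1 := hord s t hc
        have h2 := Real.rpow_le_rpow (abs_nonneg _) hc hq0
        exact mul_nonneg_of_nonpos_of_nonpos (by linarith) (by linarith)
      · have h1 := hord t s hc
        have h2 := Real.rpow_le_rpow (abs_nonneg _) hc hq0
        exact mul_nonneg (by linarith) (by linarith)

lemma dirIntegral_mem_of_two_le {q r : ℝ} (hq : 2 ≤ q) (hr : 0 ≤ r) (τ : ℝ) :
    dirIntegral q r (π / 2) ≤ dirIntegral q r τ ∧ dirIntegral q r τ ≤ dirIntegral q r 0 := by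
  have := dirIntegral_extremal (q := q) (r := r) (ε := 1) (by linarith)
    (fun s t h => by simpa using foldedWeight_mono hr (by linarith) h) τ
  simpa using this

lemma dirIntegral_mem_of_le_two {q r : ℝ} (hq : 1 ≤ q) (hq2 : q ≤ 2) (hr : 0 ≤ r) (τ : ℝ) :
    dirIntegral q r 0 ≤ dirIntegral q r τ ∧ dirIntegral q r τ ≤ dirIntegral q r (π / 2) := by
  have := dirIntegral_extremal (q := q) (r := r) (ε := -1) (by linarith)
    (fun s t h => by
      simpa using foldedWeight_anti hr (by linarith) (by linarith) h) τ
  exact ⟨by linarith [this.2], by linarith [this.1]⟩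

/-! ### Moments and their differential equation -/

/-- Negative `r` are allowed so that the moments have two-sided derivatives at `r = 0`. -/
lemma sqDist_pos_of_abs_lt {r : ℝ} (hr : |r| < 1) (s : ℝ) : 0 < sqDist r s := by
  have h : r ^ 2 < 1 := by rwa [sq_lt_one_iff_abs_lt_one]
  unfold sqDist
  nlinarith [sq_nonneg (r - Real.cos s), Real.cos_sq_le_one s, sq_nonneg (1 - r * Real.cos s),
    Real.sin_sq_add_cos_sq s, mul_nonneg (sub_pos.2 h).le (sub_nonneg.2 (Real.cos_sq_le_one s))]

lemma continuous_sqDist : Continuous fun x : ℝ × ℝ => sqDist x.1 x.2 := by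
  unfold sqDist; fun_prop

/-- The moments `∫_0^π sin^q s cos^i s |1 - r e^{is}|^{2e} ds`. -/
def moment (q e : ℝ) (i : ℕ) (r : ℝ) : ℝ :=
  ∫ s in (0 : ℝ)..π, Real.sin s ^ q * Real.cos s ^ i * sqDist r s ^ e

lemma continuous_momentIntegrand {q : ℝ} (hq : 0 ≤ q) (e : ℝ) (i : ℕ) {r : ℝ} (hr : |r| < 1) :
    Continuous fun s => Real.sin s ^ q * Real.cos s ^ i * sqDist r s ^ e := by
  have : Continuous (sqDist r) := by unfold sqDist; fun_prop
  refine Continuous.mul (Continuous.mul (Continuous.rpow_const (by fun_prop) fun s => Or.inr hq)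
    (by fun_prop)) (this.rpow_const fun s => Or.inl (sqDist_pos_of_abs_lt hr s).ne')

lemma hasDerivAt_sqDist_left (r s : ℝ) :
    HasDerivAt (fun r => sqDist r s) (2 * r - 2 * Real.cos s) r := by
  have h := (((hasDerivAt_id r).pow 2).const_add 1).sub
    (((hasDerivAt_id r).const_mul 2).mul_const (Real.cos s))
  refine h.congr_deriv ?_
  simp

lemma hasDerivAt_moment {q : ℝ} (hq : 0 ≤ q) (e : ℝ) (i : ℕ) {r : ℝ} (hr : |r| < 1) :
    HasDerivAt (moment q e i)
      (e * (2 * r * moment q (e - 1) i r - 2 * moment q (e - 1) (i + 1) r)) r := by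
  set δ := (1 - |r|) / 2 with hδ
  have hδ0 : 0 < δ := by simp only [hδ]; linarith
  have hlt : ∀ x ∈ closedBall r δ, |x| < 1 := by
    intro x hx
    have h1 : |x - r| ≤ δ := by simpa [dist_eq_norm] using hx
    have h2 := abs_add_le (x - r) r
    rw [sub_add_cancel] at h2
    linarith
  set F' : ℝ → ℝ → ℝ := fun x s => Real.sin s ^ q * Real.cos s ^ i *
    ((2 * x - 2 * Real.cos s) * e * sqDist x s ^ (e - 1)) with hF'
  have hsin : Continuous fun s => Real.sin s ^ q :=
    Continuous.rpow_const (by fun_prop) fun s => Or.inr hq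
  have hF'c : ContinuousOn (fun x : ℝ × ℝ => F' x.1 x.2) (closedBall r δ ×ˢ Icc 0 π) := by
    refine ContinuousOn.mul (Continuous.continuousOn ?_) (ContinuousOn.mul
      (Continuous.continuousOn (by fun_prop)) (continuous_sqDist.continuousOn.rpow_const ?_))
    · exact (hsin.comp continuous_snd).mul (by fun_prop)
    · exact fun x hx => Or.inl (sqDist_pos_of_abs_lt (hlt x.1 hx.1) x.2).ne'
  obtain ⟨B, hB⟩ :=
    ((isCompact_closedBall r δ).prod isCompact_Icc).exists_bound_of_continuousOn hF'c
  have key := intervalIntegral.hasDerivAt_integral_of_dominated_loc_of_deriv_le (μ := volume)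
    (F := fun x s => Real.sin s ^ q * Real.cos s ^ i * sqDist x s ^ e) (F' := F')
    (bound := fun _ => B) (a := 0) (b := π) (x₀ := r) (closedBall_mem_nhds r hδ0) ?_ ?_ ?_ ?_ ?_ ?_
  · refine key.2.congr_deriv ?_
    have h1 := (continuous_momentIntegrand hq (e - 1) i hr).intervalIntegrable (μ := volume) 0 π
    have h2 := (continuous_momentIntegrand hq (e - 1) (i + 1) hr).intervalIntegrable
      (μ := volume) 0 π
    rw [moment, moment, ← intervalIntegral.integral_const_mul,
      ← intervalIntegral.integral_const_mul, ← intervalIntegral.integral_sub (h1.const_mul _)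
      (h2.const_mul _), ← intervalIntegral.integral_const_mul]
    refine intervalIntegral.integral_congr fun s _ => ?_
    simp only [hF']
    ring
  · filter_upwards [closedBall_mem_nhds r hδ0] with x hx
    exact (continuous_momentIntegrand hq e i (hlt x hx)).aestronglyMeasurable
  · exact (continuous_momentIntegrand hq e i hr).intervalIntegrable _ _
  · have hc : ContinuousOn (F' r) (Icc 0 π) :=
      hF'c.comp (f := fun s => (r, s)) (by fun_prop)
        fun s hs => ⟨mem_closedBall_self hδ0.le, hs⟩
    rw [uIoc_of_le pi_pos.le]
    exact (hc.mono Ioc_subset_Icc_self).aestronglyMeasurable measurableSet_Ioc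
  · refine Eventually.of_forall fun s hs x hx => ?_
    rw [uIoc_of_le pi_pos.le] at hs
    exact hB (x, s) ⟨hx, Ioc_subset_Icc_self hs⟩
  · exact intervalIntegrable_const
  · refine Eventually.of_forall fun s _ x hx => ?_
    exact ((hasDerivAt_sqDist_left x s).rpow_const
      (Or.inl (sqDist_pos_of_abs_lt (hlt x hx) s).ne')).const_mul _

/-- One factor `1 + r² - 2 r cos s` is split off. This lets all moments be brought to one common
exponent. -/
lemma moment_eq_lower {q : ℝ} (hq : 0 ≤ q) (e : ℝ) (i : ℕ) {r : ℝ} (hr : |r| < 1) :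
    moment q e i r =
      (1 + r ^ 2) * moment q (e - 1) i r - 2 * r * moment q (e - 1) (i + 1) r := by
  have h1 := (continuous_momentIntegrand hq (e - 1) i hr).intervalIntegrable (μ := volume) 0 π
  have h2 := (continuous_momentIntegrand hq (e - 1) (i + 1) hr).intervalIntegrable (μ := volume) 0 π
  simp only [moment]
  rw [← intervalIntegral.integral_const_mul,
    ← intervalIntegral.integral_const_mul, ← intervalIntegral.integral_sub (h1.const_mul _)
    (h2.const_mul _)]
  refine intervalIntegral.integral_congr fun s _ => ?_
  have h := sqDist_pos_of_abs_lt hr s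
  have h3 : sqDist r s ^ e = sqDist r s * sqDist r s ^ (e - 1) := by
    rw [Real.rpow_sub_one h.ne']; field_simp
  simp only [h3]
  nth_rw 1 [sqDist]
  ring

/-- Integration by parts for `sin^{q+1} s · |1 - r e^{is}|^{2e}`. -/
lemma moment_by_parts {q : ℝ} (hq : 0 ≤ q) (e : ℝ) {r : ℝ} (hr : |r| < 1) :
    (q + 1) * moment q e 1 r + 2 * e * r * (moment q (e - 1) 0 r - moment q (e - 1) 2 r) = 0 := by
  have h1 := (continuous_momentIntegrand hq e 1 hr).intervalIntegrable (μ := volume) 0 π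
  have h2 := (continuous_momentIntegrand hq (e - 1) 0 hr).intervalIntegrable (μ := volume) 0 π
  have h3 := (continuous_momentIntegrand hq (e - 1) 2 hr).intervalIntegrable (μ := volume) 0 π
  set f' : ℝ → ℝ := fun s => (q + 1) * (Real.sin s ^ q * Real.cos s ^ 1 * sqDist r s ^ e) +
    2 * e * r * (Real.sin s ^ q * Real.cos s ^ 0 * sqDist r s ^ (e - 1) -
      Real.sin s ^ q * Real.cos s ^ 2 * sqDist r s ^ (e - 1)) with hf'
  have hint : IntervalIntegrable f' volume 0 π :=
    (h1.const_mul _).add ((h2.sub h3).const_mul _)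
  have hFTC := intervalIntegral.integral_eq_sub_of_hasDerivAt_of_le
    (f := fun s => Real.sin s ^ (q + 1) * sqDist r s ^ e) (f' := f') pi_pos.le ?_ ?_ hint
  -- The boundary terms vanish because `sin^{q+1}` does at `0` and `π`.
  · rw [Real.sin_pi, Real.sin_zero, Real.zero_rpow (by linarith), zero_mul, zero_mul, sub_zero,
      hf', intervalIntegral.integral_add (h1.const_mul _) ((h2.sub h3).const_mul _),
      intervalIntegral.integral_const_mul, intervalIntegral.integral_const_mul,
      intervalIntegral.integral_sub h2 h3] at hFTC
    exact hFTC
  · have : Continuous (sqDist r) := by unfold sqDist; fun_prop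
    exact ((Continuous.rpow_const (by fun_prop) fun s => Or.inr (by linarith)).mul
      (this.rpow_const fun s => Or.inl (sqDist_pos_of_abs_lt hr s).ne')).continuousOn
  · intro s hs
    have hs0 := Real.sin_pos_of_mem_Ioo hs
    have hD := sqDist_pos_of_abs_lt hr s
    have d1 := (Real.hasDerivAt_sin s).rpow_const (p := q + 1) (Or.inl hs0.ne')
    have d2 : HasDerivAt (sqDist r) (2 * r * Real.sin s) s := by
      refine ((((Real.hasDerivAt_cos s).const_mul (2 * r)).const_sub (1 + r ^ 2))).congr_deriv ?_
      ring
    refine (d1.mul (d2.rpow_const (p := e) (Or.inl hD.ne'))).congr_deriv ?_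
    have e1 : Real.sin s ^ (q + 1) = Real.sin s ^ q * Real.sin s := Real.rpow_add_one hs0.ne' q
    have e2 : Real.cos s ^ 2 = 1 - Real.sin s ^ 2 := by
      linarith [Real.sin_sq_add_cos_sq s]
    simp only [hf', e1, e2, add_sub_cancel_right]
    ring

lemma dirIntegral_half_pi {q : ℝ} (hq : 1 ≤ q) (r : ℝ) :
    dirIntegral q r (π / 2) = 2 * moment q (q - 1) 0 r := by
  have hc := continuous_dirIntegrand hq r (π / 2)
  rw [dirIntegral, ← intervalIntegral.integral_add_adjacent_intervals (b := 0)
    (hc.intervalIntegrable _ _) (hc.intervalIntegrable _ _)]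
  have h1 : ∫ s in (0 : ℝ)..π, |Real.cos (s + π / 2)| ^ q * sqDist r s ^ (q - 1) =
      moment q (q - 1) 0 r := by
    refine intervalIntegral.integral_congr fun s hs => ?_
    rw [uIcc_of_le pi_pos.le] at hs
    simp only [Real.cos_add_pi_div_two, abs_neg, pow_zero, mul_one,
      abs_of_nonneg (Real.sin_nonneg_of_mem_Icc hs)]
  have h2 : ∫ s in (-π)..0, |Real.cos (s + π / 2)| ^ q * sqDist r s ^ (q - 1) =
      ∫ s in (0 : ℝ)..π, |Real.cos (s + π / 2)| ^ q * sqDist r s ^ (q - 1) := by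
    have := intervalIntegral.integral_comp_neg (a := -π) (b := 0)
      (fun s => |Real.cos (s + π / 2)| ^ q * sqDist r s ^ (q - 1))
    rw [neg_neg, neg_zero] at this
    rw [← this]
    refine intervalIntegral.integral_congr fun s _ => ?_
    simp only [Real.cos_add_pi_div_two, Real.sin_neg, abs_neg, sqDist, Real.cos_neg]
  rw [h2, h1]
  ring

lemma moment_zero_pos {q : ℝ} (hq : 1 ≤ q) {r : ℝ} (hr : 0 ≤ r) (hr1 : r < 1) :
    0 < moment q (q - 1) 0 r := by
  have := dirIntegral_pos hq hr hr1 (π / 2)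
  rw [dirIntegral_half_pi hq] at this
  linarith

/-- The differential equation of `r ↦ ∫_0^π sin^q s |1 - r e^{is}|^{2(q-1)} ds`. -/
lemma moment_ode {q : ℝ} (hq : 0 ≤ q) {r : ℝ} (hr : |r| < 1) :
    ∃ I₁ : ℝ → ℝ, ∃ I₂ : ℝ, (∀ x, |x| < 1 → HasDerivAt (moment q (q - 1) 0) (I₁ x) x) ∧
      HasDerivAt I₁ I₂ r ∧
      (1 - r ^ 2) * (r * I₂ + (3 - 2 * q) * I₁ r) +
        (3 * q - 2) * ((1 + r ^ 2) * I₁ r - 2 * (q - 1) * r * moment q (q - 1) 0 r) = 0 := by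
  have d0 := hasDerivAt_moment hq (q - 1 - 1) 0 hr
  have d1 := hasDerivAt_moment hq (q - 1 - 1) 1 hr
  refine ⟨fun x => (q - 1) * (2 * x * moment q (q - 1 - 1) 0 x - 2 * moment q (q - 1 - 1) 1 x), _,
    fun x hx => hasDerivAt_moment hq (q - 1) 0 hx,
    ((((hasDerivAt_id r).const_mul 2).mul d0).sub (d1.const_mul 2)).const_mul _, ?_⟩
  have r0 := moment_eq_lower hq (q - 1) 0 hr
  have r1 := moment_eq_lower hq (q - 1 - 1) 0 hr
  have r2 := moment_eq_lower hq (q - 1 - 1) 1 hr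
  have b := moment_by_parts hq (q - 1 - 1) hr
  simp only [id, zero_add, Nat.reduceAdd, mul_one] at r0 r1 r2 b ⊢
  -- Everything is lowered to the three moments of exponent `q - 3`; the equation is then a multiple
  -- of the integration by parts identity.
  rw [r0]
  generalize moment q (q - 1 - 1 - 1) 0 r = L0 at *
  generalize moment q (q - 1 - 1 - 1) 1 r = L1 at *
  generalize moment q (q - 1 - 1 - 1) 2 r = L2 at *
  rw [r1]
  rw [r2] at b ⊢
  linear_combination (-2 * (q - 1) * (1 - r ^ 2)) * b

/-! ### The hypergeometric equation and the closed form -/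

/-- Power series with radius of convergence at least one. -/
def UnitConvergent (c : ℕ → ℝ) : Prop := ∀ ρ : ℝ, 0 ≤ ρ → ρ < 1 → Summable fun n => |c n| * ρ ^ n

lemma UnitConvergent.natCast_mul {c : ℕ → ℝ} (hc : UnitConvergent c) :
    UnitConvergent fun n => n * c n := by
  intro ρ hρ0 hρ1
  obtain ⟨σ, hσ, hσ1⟩ := exists_between hρ1
  have hσ0 : 0 < σ := hρ0.trans_lt hσ
  have hlim : Tendsto (fun n : ℕ => (n : ℝ) * (ρ / σ) ^ n) atTop (𝓝 0) :=
    tendsto_self_mul_const_pow_of_lt_one (by positivity) ((div_lt_one hσ0).2 hσ)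
  refine summable_of_isBigO_nat (hc σ hσ0.le hσ1) ?_
  have h1 := (hlim.isBigO_one ℝ).mul (Asymptotics.isBigO_refl (fun n => |c n| * σ ^ n) atTop)
  simp only [one_mul] at h1
  refine h1.congr_left fun n => ?_
  rw [abs_mul, Nat.abs_cast, div_pow]
  field_simp

lemma UnitConvergent.summable {c : ℕ → ℝ} (hc : UnitConvergent c) {x : ℝ} (hx : |x| < 1) :
    Summable fun n => c n * x ^ n := by
  refine Summable.of_norm ?_
  simpa [abs_mul, abs_pow] using hc |x| (abs_nonneg x) hx

/-- The operator `x d/dx` multiplies the coefficients by `n` without shifting the index, so it can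
be iterated within this class of series. -/
lemma UnitConvergent.mul_hasDerivAt {c : ℕ → ℝ} (hc : UnitConvergent c) {x : ℝ} (hx : |x| < 1) :
    ∃ d, HasDerivAt (fun x => ∑' n, c n * x ^ n) d x ∧ x * d = ∑' n : ℕ, n * c n * x ^ n := by
  obtain ⟨σ, hσ, hσ1⟩ := exists_between hx
  have hσ0 : 0 < σ := (abs_nonneg x).trans_lt hσ
  have hs : Summable fun n : ℕ => σ⁻¹ * (|n * c n| * σ ^ n) :=
    (hc.natCast_mul σ hσ0.le hσ1).mul_left _
  have hd := hasDerivAt_tsum_of_isPreconnected (t := ball (0 : ℝ) σ) (y₀ := 0) (y := x)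
    (g := fun n x => c n * x ^ n) (g' := fun n x => c n * (n * x ^ (n - 1))) hs isOpen_ball
    (convex_ball _ _).isPreconnected
    (fun n y _ => (hasDerivAt_pow n y).const_mul (c n)) (fun n y hy => ?_)
    (mem_ball_self hσ0) (hc.summable (by simp)) (by simpa using hσ)
  · refine ⟨_, hd, ?_⟩
    rw [← tsum_mul_left]
    refine tsum_congr fun n => ?_
    rcases n with _ | n
    · simp
    · rw [Nat.add_sub_cancel, pow_succ]; ring
  · rw [Real.norm_eq_abs, abs_mul, abs_mul, abs_mul, abs_pow, Nat.abs_cast]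
    rcases n with _ | n
    · simp
    · have hy' : |y| ≤ σ := by simpa using (mem_ball_zero_iff.1 hy).le
      rw [Nat.add_sub_cancel, pow_succ]
      calc |c (n + 1)| * ((n + 1 : ℕ) * |y| ^ n) ≤ |c (n + 1)| * ((n + 1 : ℕ) * σ ^ n) := by gcongr
        _ = σ⁻¹ * ((n + 1 : ℕ) * |c (n + 1)| * (σ ^ n * σ)) := by field_simp

lemma hypergeometricCoefficient_succ (A B : ℝ) {C : ℝ} (hC : 0 < C) (n : ℕ) :
    (n + 1) * (C + n) * ordinaryHypergeometricCoefficient A B C (n + 1) =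
      (A + n) * (B + n) * ordinaryHypergeometricCoefficient A B C n := by
  have h1 : (ascPochhammer ℝ n).eval C ≠ 0 := (ascPochhammer_pos n C hC).ne'
  have h2 : (n.factorial : ℝ) ≠ 0 := by positivity
  have h3 : C + n ≠ 0 := by positivity
  simp only [ordinaryHypergeometricCoefficient, ascPochhammer_succ_eval, Nat.factorial_succ]
  push_cast
  field_simp

lemma unitConvergent_hypergeometric (A B : ℝ) {C : ℝ} (hC : 0 < C) :
    UnitConvergent (ordinaryHypergeometricCoefficient A B C) := by
  intro ρ hρ0 hρ1
  set c := ordinaryHypergeometricCoefficient A B C with hc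
  obtain ⟨σ, hσ, hσ1⟩ := exists_between hρ1
  have hlim : Tendsto (fun n : ℕ => |(A + n) / (1 + n) * ((B + n) / (C + n))| * ρ) atTop (𝓝 ρ) := by
    have h1 : ∀ a b : ℝ, Tendsto (fun n : ℕ => (a + n) / (b + n)) atTop (𝓝 1) := fun a b => by
      have := tendsto_add_mul_div_add_mul_atTop_nhds a b (1 : ℝ) one_ne_zero
      simpa using this
    have := ((h1 A 1).mul (h1 B C)).abs.mul_const ρ
    simpa using this
  refine summable_of_ratio_norm_eventually_le (r := σ) hσ1 ?_
  filter_upwards [hlim.eventually_lt_const hσ] with n hn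
  have h := hypergeometricCoefficient_succ A B hC n
  have h3 : C + n ≠ 0 := by positivity
  have h4 : (1 + n : ℝ) ≠ 0 := by positivity
  have h5 : c (n + 1) = (A + n) / (1 + n) * ((B + n) / (C + n)) * c n := by
    rw [← hc] at h
    field_simp
    linarith
  rw [h5]
  generalize (A + n) / (1 + n) * ((B + n) / (C + n)) = y at *
  simp only [Real.norm_eq_abs, abs_mul, abs_abs, abs_pow, abs_of_nonneg hρ0, pow_succ]
  calc |y| * |c n| * (ρ ^ n * ρ) = |y| * ρ * (|c n| * ρ ^ n) := by ring
    _ ≤ σ * (|c n| * ρ ^ n) := by gcongr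

/-- This is the hypergeometric equation in Euler form, `θ(θ + C - 1)F = x(θ + A)(θ + B)F` with `θ =
x d/dx`; comparing coefficients gives the recursion for consecutive coefficients. -/
lemma hypergeometric_recursion (A B : ℝ) {C : ℝ} (hC : 0 < C) {x : ℝ} (hx : |x| < 1) :
    let c := ordinaryHypergeometricCoefficient A B C
    (∑' n : ℕ, n * (n * c n) * x ^ n) + (C - 1) * ∑' n : ℕ, n * c n * x ^ n =
      x * ((∑' n : ℕ, n * (n * c n) * x ^ n) + (A + B) * (∑' n : ℕ, n * c n * x ^ n) +
        A * B * ∑' n : ℕ, c n * x ^ n) := by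
  intro c
  have hc : UnitConvergent c := unitConvergent_hypergeometric A B hC
  have s0 := hc.summable hx
  have s1 := hc.natCast_mul.summable hx
  have s2 := hc.natCast_mul.natCast_mul.summable hx
  rw [← tsum_mul_left, ← tsum_mul_left, ← tsum_mul_left, ← s2.tsum_add (s1.mul_left _),
    ← s2.tsum_add (s1.mul_left _), ← (s2.add (s1.mul_left _)).tsum_add (s0.mul_left _),
    ← tsum_mul_left, (s2.add (s1.mul_left _)).tsum_eq_zero_add]
  simp only [Nat.cast_zero, zero_mul, mul_zero, zero_add]
  refine tsum_congr fun n => ?_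
  have h := hypergeometricCoefficient_succ A B hC n
  push_cast
  rw [pow_succ]
  change (n + 1) * (C + n) * c (n + 1) = (A + n) * (B + n) * c n at h
  linear_combination (x ^ n * x) * h

/-- The differential equation of `r ↦ ₂F₁(A, B; C; r²)`. -/
lemma hypergeometric_sq_ode (A B : ℝ) {C : ℝ} (hC : 0 < C) :
    ∃ G₁ T T₁ : ℝ → ℝ, ∀ r, |r| < 1 →
      HasDerivAt (fun r => ordinaryHypergeometric A B C (r ^ 2)) (G₁ r) r ∧ r * G₁ r = T r ∧
      HasDerivAt T (T₁ r) r ∧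
        (1 - r ^ 2) * (r * T₁ r) + 2 * ((C - 1) - (A + B) * r ^ 2) * T r -
          4 * A * B * r ^ 2 * ordinaryHypergeometric A B C (r ^ 2) = 0 := by
  set c := ordinaryHypergeometricCoefficient A B C with hcdef
  have hc : UnitConvergent c := unitConvergent_hypergeometric A B hC
  have hF : ∀ x : ℝ, ordinaryHypergeometric A B C x = ∑' n : ℕ, c n * x ^ n := fun x => by
    rw [ordinaryHypergeometric_eq_tsum]; rfl
  simp only [hF]
  have hsq : ∀ {r : ℝ}, |r| < 1 → |r ^ 2| < 1 := fun hr => by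
    rw [abs_pow]; exact pow_lt_one₀ (abs_nonneg _) hr (by norm_num)
  have hd : ∀ {c : ℕ → ℝ}, UnitConvergent c → ∀ r, |r| < 1 → ∃ d,
      HasDerivAt (fun r => ∑' n, c n * (r ^ 2) ^ n) d r ∧
        r * d = 2 * ∑' n : ℕ, n * c n * (r ^ 2) ^ n := by
    intro c hc r hr
    obtain ⟨d, h1, h2⟩ := hc.mul_hasDerivAt (hsq hr)
    refine ⟨_, HasDerivAt.comp r (h₂ := fun x => ∑' n, c n * x ^ n) (h := fun r : ℝ => r ^ 2)
      h1 (hasDerivAt_pow 2 r), ?_⟩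
    rw [← h2]; simp; ring
  choose! G₁ hG₁ hG₁' using hd hc
  choose! T₁ hT₁ hT₁' using hd hc.natCast_mul
  refine ⟨G₁, _, fun r => 2 * T₁ r, fun r hr =>
    ⟨hG₁ r hr, hG₁' r hr, (hT₁ r hr).const_mul 2, ?_⟩⟩
  have hrec := hypergeometric_recursion A B hC (hsq hr)
  simp only at hrec
  rw [← hcdef] at hrec
  linear_combination 4 * hrec + (1 - r ^ 2) * 2 * hT₁' r hr

/-- The substitution `x = (1 - cos s)/2` gives `2^q B(u, u)` with `u = (1 + q)/2`, and Legendre's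
duplication formula turns this into `B(u, 1/2)`. -/
lemma integral_sin_rpow {q : ℝ} (hq : 1 ≤ q) :
    ∫ s in (0 : ℝ)..π, Real.sin s ^ q = ProbabilityTheory.beta ((1 + q) / 2) (1 / 2) := by
  set u := (1 + q) / 2 with hu
  have hu0 : 0 < u := by simp only [hu]; linarith
  have h1 : ProbabilityTheory.beta u u = ∫ x in (0 : ℝ)..1, x ^ (u - 1) * (1 - x) ^ (u - 1) := by
    rw [ProbabilityTheory.beta_eq_betaIntegralReal u u hu0 hu0, Complex.betaIntegral,
      ← Complex.ofReal_re (∫ x in (0 : ℝ)..1, x ^ (u - 1) * (1 - x) ^ (u - 1)),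
      ← intervalIntegral.integral_ofReal]
    congr 1
    refine intervalIntegral.integral_congr fun x hx => ?_
    rw [uIcc_of_le zero_le_one] at hx
    rw [Complex.ofReal_mul, Complex.ofReal_cpow hx.1, Complex.ofReal_cpow (by linarith [hx.2])]
    push_cast
    rfl
  have hc : Continuous fun x : ℝ => x ^ (u - 1) * (1 - x) ^ (u - 1) := by
    have h0 : 0 ≤ u - 1 := by simp only [hu]; linarith
    exact (continuous_id.rpow_const fun _ => Or.inr h0).mul
      ((continuous_const.sub continuous_id).rpow_const fun _ => Or.inr h0)
  have h2 := intervalIntegral.integral_comp_mul_deriv (a := 0) (b := π)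
    (f := fun s => (1 - Real.cos s) / 2) (f' := fun s => Real.sin s / 2)
    (fun s _ => (((Real.hasDerivAt_cos s).const_sub 1).div_const 2).congr_deriv (by ring))
    (Continuous.continuousOn (by fun_prop)) hc
  simp only [Real.cos_zero, Real.cos_pi, sub_self, zero_div, sub_neg_eq_add,
    show (1 + 1 : ℝ) / 2 = 1 by norm_num] at h2
  rw [← h1] at h2
  have h3 : ∫ s in (0 : ℝ)..π, Real.sin s ^ q = 2 ^ q * ProbabilityTheory.beta u u := by
    rw [← h2, ← intervalIntegral.integral_const_mul]
    refine intervalIntegral.integral_congr fun s hs => ?_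
    rw [uIcc_of_le pi_pos.le] at hs
    have hs0 := Real.sin_nonneg_of_mem_Icc hs
    have e : ((1 - Real.cos s) / 2) * (1 - (1 - Real.cos s) / 2) = (Real.sin s / 2) ^ (2 : ℝ) := by
      rw [Real.rpow_ofNat]
      linarith [Real.sin_sq_add_cos_sq s]
    have hq1 : (2 : ℝ) * (u - 1) = q - 1 := by simp only [hu]; ring
    simp only [Function.comp]
    rw [← Real.mul_rpow (by linarith [Real.cos_le_one s]) (by linarith [Real.neg_one_le_cos s]), e,
      ← Real.rpow_mul (by positivity), hq1]
    rcases hs0.eq_or_lt with h | h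
    · rw [← h, Real.zero_rpow (by linarith)]; simp
    · rw [← Real.rpow_add_one (by positivity), sub_add_cancel, Real.div_rpow hs0 (by norm_num)]
      field_simp
  have hG := Real.Gamma_mul_Gamma_add_half u
  rw [h3, ProbabilityTheory.beta, ProbabilityTheory.beta, Real.Gamma_one_half_eq, ← two_mul]
  have g1 : Real.Gamma (2 * u) ≠ 0 := (Real.Gamma_pos_of_pos (by positivity)).ne'
  have g2 : Real.Gamma (u + 1 / 2) ≠ 0 := (Real.Gamma_pos_of_pos (by positivity)).ne'
  have hq2 : (2 : ℝ) ^ (1 - 2 * u) = (2 ^ q)⁻¹ := by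
    rw [← Real.rpow_neg (by norm_num)]; congr 1; simp only [hu]; ring
  rw [hq2] at hG
  field_simp at hG ⊢
  linear_combination hG

lemma moment_at_zero {q : ℝ} (hq : 1 ≤ q) :
    moment q (q - 1) 0 0 = ProbabilityTheory.beta ((1 + q) / 2) (1 / 2) := by
  rw [← integral_sin_rpow hq]
  refine intervalIntegral.integral_congr fun s _ => ?_
  simp [sqDist]

/-- The moment is a hypergeometric function of `r²`. -/
lemma moment_eq_hypergeometric {q : ℝ} (hq : 1 ≤ q) {r : ℝ} (hr : 0 ≤ r) (hr1 : r < 1) :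
    moment q (q - 1) 0 r = ProbabilityTheory.beta ((1 + q) / 2) (1 / 2) *
      ordinaryHypergeometric (1 - 3 * q / 2) (1 - q) (1 + q / 2) (r ^ 2) := by
  rcases hr.eq_or_lt with rfl | hr0
  · rw [moment_at_zero hq]; simp
  have hq0 : 0 ≤ q := by linarith
  set I := moment q (q - 1) 0 with hI
  obtain ⟨G₁, T, T₁, hode⟩ := hypergeometric_sq_ode (1 - 3 * q / 2) (1 - q)
    (C := 1 + q / 2) (by linarith)
  set G := fun r : ℝ => ordinaryHypergeometric (1 - 3 * q / 2) (1 - q) (1 + q / 2) (r ^ 2) with hG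
  -- `moment_ode` supplies a derivative function separately for each point; `deriv I` replaces them
  -- by a single one.
  set I₁ : ℝ → ℝ := deriv I with hI₁
  have hIode : ∀ x, |x| < 1 → HasDerivAt I (I₁ x) x ∧ ∃ I₂, HasDerivAt I₁ I₂ x ∧
      (1 - x ^ 2) * (x * I₂ + (3 - 2 * q) * I₁ x) +
        (3 * q - 2) * ((1 + x ^ 2) * I₁ x - 2 * (q - 1) * x * I x) = 0 := by
    intro x hx
    obtain ⟨J, I₂, h1, h2, h3⟩ := moment_ode hq0 hx
    have hJ : ∀ y, |y| < 1 → I₁ y = J y := fun y hy => (h1 y hy).deriv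
    have hev : I₁ =ᶠ[𝓝 x] J := by
      have : {y : ℝ | |y| < 1} ∈ 𝓝 x := (isOpen_lt continuous_abs continuous_const).mem_nhds hx
      filter_upwards [this] with y hy using hJ y hy
    rw [hJ x hx]
    exact ⟨h1 x hx, I₂, h2.congr_of_eventuallyEq hev, h3⟩
  have habs : ∀ {x}, x ∈ Icc 0 r → |x| < 1 := fun hx => by
    rw [abs_of_nonneg hx.1]; linarith [hx.2]
  have hpos : ∀ {x}, x ∈ Icc 0 r → 0 < I x := fun {x} hx =>
    moment_zero_pos hq hx.1 (by linarith [hx.2])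
  -- the weighted Wronskian is constant
  have hW : ∀ x ∈ Ioo 0 r, I x * T x - G x * (x * I₁ x) = 0 := by
    intro x hx
    have hxr : ∀ {y}, y ∈ Icc 0 x → y ∈ Icc 0 r := fun hy => ⟨hy.1, hy.2.trans hx.2.le⟩
    -- The common equation gives `(1 - y²) y W' + (q + (5q - 4) y²) W = 0` for the Wronskian `W`
    -- formed with `y d/dy`; `y^q (1 - y²)^{2-3q}` is its integrating factor. As `q > 0`, the
    -- product vanishes at `0`, hence everywhere.
    set Φ : ℝ → ℝ := fun y =>
      y ^ q * (1 - y ^ 2) ^ (2 - 3 * q) * (I y * T y - G y * (y * I₁ y)) with hΦ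
    have hder : ∀ y ∈ Ioo 0 x, HasDerivAt Φ 0 y := by
      intro y hy
      have hy1 : y < 1 := by linarith [hy.2, hx.2]
      have hy2 : 0 < 1 - y ^ 2 := by nlinarith [hy.1]
      have hya := habs (hxr (Ioo_subset_Icc_self hy))
      obtain ⟨dI, I₂, dI₁, eI⟩ := hIode y hya
      obtain ⟨dG, eTG, dT, eT⟩ := hode y hya
      have d1 := (hasDerivAt_id y).rpow_const (p := q) (Or.inl hy.1.ne')
      have d2 := ((hasDerivAt_pow 2 y).const_sub 1).rpow_const (p := 2 - 3 * q) (Or.inl hy2.ne')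
      refine ((d1.mul d2).mul ((dI.mul dT).sub
        (dG.mul ((hasDerivAt_id y).mul dI₁)))).congr_deriv ?_
      have e1 : y ^ q = y ^ (q - 1) * y := by
        rw [← Real.rpow_add_one hy.1.ne', sub_add_cancel]
      have e2 : (1 - y ^ 2) ^ (2 - 3 * q) = (1 - y ^ 2) ^ (2 - 3 * q - 1) * (1 - y ^ 2) := by
        rw [← Real.rpow_add_one hy2.ne', sub_add_cancel]
      have eg : ordinaryHypergeometric (1 - 3 * q / 2) (1 - q) (1 + q / 2) (y ^ 2) = G y := rfl
      rw [eg] at eT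
      simp only [id, Pi.mul_apply, Pi.sub_apply, e1, e2]
      generalize y ^ (q - 1) = P
      generalize (1 - y ^ 2) ^ (2 - 3 * q - 1) = R
      linear_combination P * R * (I y * eT - G y * y * eI) - P * R * y * (1 - y ^ 2) * I₁ y * eTG
    have hcont : ContinuousOn Φ (Icc 0 x) := by
      intro y hy
      have hya := habs (hxr hy)
      have hy2 : 0 < 1 - y ^ 2 := by nlinarith [hy.1, hy.2, hx.2]
      obtain ⟨dI, I₂, dI₁, -⟩ := hIode y hya
      obtain ⟨dG, -, dT, -⟩ := hode y hya
      refine ContinuousAt.continuousWithinAt (ContinuousAt.mul (ContinuousAt.mul ?_ ?_)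
        ((dI.continuousAt.mul dT.continuousAt).sub
          (dG.continuousAt.mul (continuousAt_id.mul dI₁.continuousAt))))
      · exact continuousAt_id.rpow_const (Or.inr hq0)
      · exact ContinuousAt.rpow_const (by fun_prop) (Or.inl hy2.ne')
    obtain ⟨c, hc, hslope⟩ := exists_hasDerivAt_eq_slope Φ (fun _ => 0) hx.1 hcont hder
    have hΦ0 : Φ 0 = 0 := by simp [hΦ, Real.zero_rpow (show q ≠ 0 by linarith)]
    rw [hΦ0, sub_zero, sub_zero, eq_comm, div_eq_zero_iff] at hslope
    have h2 : 0 < 1 - x ^ 2 := by nlinarith [hx.1, hx.2]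
    have h3 : 0 < x ^ q * (1 - x ^ 2) ^ (2 - 3 * q) :=
      mul_pos (Real.rpow_pos_of_pos hx.1 _) (Real.rpow_pos_of_pos h2 _)
    rcases hslope with h | h
    · exact (mul_eq_zero.1 h).resolve_left h3.ne'
    · exact absurd h hx.1.ne'
  have hcontQ : ContinuousOn (fun x => G x / I x) (Icc 0 r) := fun x hx =>
    ((hode x (habs hx)).1.continuousAt.div (hIode x (habs hx)).1.continuousAt
      (hpos hx).ne').continuousWithinAt
  -- The vanishing Wronskian makes `G / I` constant on `[0, r]`; its value at `0` fixes the factor.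
  obtain ⟨c, hc, hslope⟩ := exists_hasDerivAt_eq_slope (fun x => G x / I x) (fun _ => 0) hr0 hcontQ
    (fun x hx => by
      have hx' := Ioo_subset_Icc_self hx
      refine ((hode x (habs hx')).1.div (hIode x (habs hx')).1 (hpos hx').ne').congr_deriv ?_
      rw [div_eq_zero_iff]
      left
      have h := hW x hx
      rw [← (hode x (habs hx')).2.1] at h
      refine (mul_eq_zero.1 (?_ : x * _ = 0)).resolve_left hx.1.ne'
      simp only [hG] at h
      linear_combination h)
  rw [eq_comm, div_eq_zero_iff, sub_eq_zero] at hslope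
  rcases hslope with h | h
  · have hG0 : G 0 = 1 := by simp [hG]
    have p0 := hpos (left_mem_Icc.2 hr)
    have p1 := hpos (right_mem_Icc.2 hr)
    rw [hG0, div_eq_div_iff p1.ne' p0.ne', one_mul] at h
    rw [← moment_at_zero hq, ← h]
    ring
  · exact absurd h (by linarith)

/-! ### Monotonicity in the radius -/

/-- Enlarging `1 + r²` raises both terms, and enlarging `2r|cos s|` spreads them apart, which
convexity turns into an increase. -/
lemma foldedWeight_mono_radius {a r r' : ℝ} (ha : 1 ≤ a) (hr : 0 ≤ r) (hrr : r ≤ r')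
    (s : ℝ) : foldedWeight r a s ≤ foldedWeight r' a s := by
  rw [foldedWeight_eq, foldedWeight_eq]
  have hc := abs_nonneg (Real.cos s)
  have hr0 := hr.trans hrr
  have h1 := one_add_sq_sub_nonneg hr (Real.abs_cos_le_one s)
  have h2 := one_add_sq_sub_nonneg hr0 (Real.abs_cos_le_one s)
  have hsq : r ^ 2 ≤ r' ^ 2 := by gcongr
  calc (1 + r ^ 2 - 2 * r * |Real.cos s|) ^ a + (1 + r ^ 2 + 2 * r * |Real.cos s|) ^ a
      ≤ (1 + r' ^ 2 - 2 * r * |Real.cos s|) ^ a + (1 + r' ^ 2 + 2 * r * |Real.cos s|) ^ a := by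
        gcongr
    _ ≤ _ := ConvexOn.symm_add_le (convexOn_rpow ha) (by positivity) (by gcongr) h2
        (by simp only [mem_Ici]; positivity)

lemma dirIntegral_zero_mono {q r r' : ℝ} (hq : 2 ≤ q) (hr : 0 ≤ r) (hrr : r ≤ r') :
    dirIntegral q r 0 ≤ dirIntegral q r' 0 := by
  rw [dirIntegral_eq_folded (by linarith), dirIntegral_eq_folded (by linarith)]
  have hc : ∀ r, Continuous fun s => |Real.cos (s + 0)| ^ q * foldedWeight r (q - 1) s := fun r =>
    (Continuous.rpow_const (by fun_prop) fun s => Or.inr (by linarith)).mul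
      (continuous_foldedWeight r (by linarith))
  refine mul_le_mul_of_nonneg_left (intervalIntegral.integral_mono_on (by linarith [pi_pos])
    ((hc r).intervalIntegrable _ _) ((hc r').intervalIntegrable _ _) fun s _ => ?_) (by norm_num)
  exact mul_le_mul_of_nonneg_left (foldedWeight_mono_radius (by linarith) hr hrr s)
    (by positivity)

/-- This is the sign of the `r`-derivative of the tangential integral. Integration by parts and
`sin² s ≤ |1 - r e^{is}|²` give the bound with constant `2(2 - q)/(q + 1)`, which is at most `1`
exactly because `q ≥ 1`. -/
lemma moment_one_le {q r : ℝ} (hq : 1 ≤ q) (hq2 : q ≤ 2) (hr : 0 ≤ r) (hr1 : r < 1) :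
    moment q (q - 2) 1 r ≤ r * moment q (q - 2) 0 r := by
  have hq0 : 0 ≤ q := by linarith
  have hra : |r| < 1 := by rwa [abs_of_nonneg hr]
  have hb := moment_by_parts hq0 (q - 2) hra
  have hc0 := continuous_momentIntegrand hq0 (q - 2) 0 hra
  have hc1 := continuous_momentIntegrand hq0 (q - 2 - 1) 0 hra
  have hc2 := continuous_momentIntegrand hq0 (q - 2 - 1) 2 hra
  have hle : moment q (q - 2 - 1) 0 r - moment q (q - 2 - 1) 2 r ≤ moment q (q - 2) 0 r := by
    simp only [moment]
    rw [← intervalIntegral.integral_sub (hc1.intervalIntegrable _ _) (hc2.intervalIntegrable _ _)]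
    refine intervalIntegral.integral_mono_on pi_pos.le
      ((hc1.sub hc2).intervalIntegrable _ _) (hc0.intervalIntegrable _ _) fun s hs => ?_
    have hs0 := Real.sin_nonneg_of_mem_Icc hs
    have hD := sqDist_pos_of_abs_lt hra s
    have h3 : sqDist r s ^ (q - 2) = sqDist r s ^ (q - 2 - 1) * sqDist r s := by
      rw [← Real.rpow_add_one hD.ne', sub_add_cancel]
    have h4 : 1 - Real.cos s ^ 2 ≤ sqDist r s := by
      unfold sqDist; nlinarith [sq_nonneg (r - Real.cos s)]
    rw [h3]
    calc _ = Real.sin s ^ q * (sqDist r s ^ (q - 2 - 1) * (1 - Real.cos s ^ 2)) := by ring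
      _ ≤ Real.sin s ^ q * (sqDist r s ^ (q - 2 - 1) * sqDist r s) := by gcongr
      _ = _ := by ring
  have hK0 : 0 ≤ moment q (q - 2) 0 r := by
    refine intervalIntegral.integral_nonneg pi_pos.le fun s hs => ?_
    have hs0 := Real.sin_nonneg_of_mem_Icc hs
    have hD := sqDist_pos_of_abs_lt hra s
    positivity
  have h1 : (q + 1) * moment q (q - 2) 1 r ≤ 2 * (2 - q) * (r * moment q (q - 2) 0 r) := by
    have := mul_le_mul_of_nonneg_left hle (show 0 ≤ 2 * (2 - q) * r from
      mul_nonneg (by linarith) hr)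
    linarith
  have h2 : 2 * (2 - q) * (r * moment q (q - 2) 0 r) ≤ (q + 1) * (r * moment q (q - 2) 0 r) :=
    mul_le_mul_of_nonneg_right (by linarith) (mul_nonneg hr hK0)
  exact le_of_mul_le_mul_left (h1.trans h2) (by linarith)

/-- Pointwise comparison of weights is not available here: for `1 < q < 3/2` the folded weight
decreases in `r` at `s = 0`. Only the integral is monotone. -/
lemma monotoneOn_dirIntegral_half_pi {q : ℝ} (hq : 1 ≤ q) (hq2 : q ≤ 2) :
    MonotoneOn (fun r => dirIntegral q r (π / 2)) (Ico 0 1) := by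
  have hq0 : 0 ≤ q := by linarith
  have hd : ∀ r ∈ Ico (0 : ℝ) 1, HasDerivAt (fun r => dirIntegral q r (π / 2)) _ r := fun r hr => by
    simp only [dirIntegral_half_pi hq]
    exact (hasDerivAt_moment hq0 (q - 1) 0 (by rw [abs_of_nonneg hr.1]; exact hr.2)).const_mul 2
  refine monotoneOn_of_deriv_nonneg (convex_Ico 0 1)
    (fun r hr => (hd r hr).continuousAt.continuousWithinAt)
    (fun r hr => (hd r (interior_subset hr)).differentiableAt.differentiableWithinAt)
    fun r hr => ?_
  have hr' := interior_subset hr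
  rw [(hd r hr').deriv]
  have h := moment_one_le hq hq2 hr'.1 hr'.2
  have e : q - 1 - 1 = q - 2 := by ring
  rw [e, zero_add]
  exact mul_nonneg (by norm_num) (mul_nonneg (by linarith) (by linarith))

lemma continuous_dirIntegral {q : ℝ} (hq : 1 ≤ q) (τ : ℝ) :
    Continuous fun r => dirIntegral q r τ := by
  refine intervalIntegral.continuous_parametric_intervalIntegral_of_continuous' ?_ _ _
  refine Continuous.mul ?_ (continuous_sqDist.rpow_const fun _ => Or.inr (by linarith))
  exact Continuous.rpow_const (by fun_prop) fun _ => Or.inr (by linarith)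

/-! ### The constants, their supremum and real harmonic functions -/

open Classical in
/-- The angle between the extremal direction and the radial direction. -/
def extremalAngle (p : ℝ≥0∞) : ℝ := if p < 2 then 0 else π / 2

/-- The `q`-th power of `π C_p(z)` as a function of `r = |z|`. -/
def extremalIntegral (p : ℝ≥0∞) (q r : ℝ) : ℝ := dirIntegral q r (extremalAngle p)

lemma optConst_eq (p : ℝ≥0∞) (q : ℝ) :
    optConst p q = 1 / π * extremalIntegral p q 1 ^ (1 / q) := by
  have h : ∀ s, 2 - 2 * Real.cos s = sqDist 1 s := fun s => by rw [sqDist]; ring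
  unfold optConst extremalIntegral extremalAngle
  split_ifs
  · simp only [h, div_sqDist_rpow, dirIntegral, add_zero]
  · simp only [h, div_sqDist_rpow, dirIntegral, Real.cos_add_pi_div_two, abs_neg]

lemma normalDir_eq {z : ℂ} (hz : z ≠ 0) : normalDir z = circ z.arg := by
  have h : (‖z‖ : ℂ) ≠ 0 := by simpa using hz
  rw [normalDir, div_eq_iff h, mul_comm, circ, Complex.norm_mul_exp_arg_mul_I]

lemma tangentDir_eq {z : ℂ} (hz : z ≠ 0) : tangentDir z = circ (z.arg + π / 2) := by
  have h : circ (π / 2) = Complex.I := by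
    rw [circ]; push_cast; exact Complex.exp_pi_div_two_mul_I
  rw [circ_add, h, ← normalDir_eq hz, tangentDir, normalDir, mul_comm]

lemma dirIntegral_zero_radius {q : ℝ} (τ : ℝ) :
    dirIntegral q 0 τ = dirIntegral q 0 0 := by
  have hp : Function.Periodic (fun s => |Real.cos s| ^ q) (2 * π) := fun s => by
    simp only [Real.cos_add_two_pi]
  have key : ∀ τ, dirIntegral q 0 τ = ∫ s in (-π)..π, |Real.cos s| ^ q := by
    intro τ
    simp only [dirIntegral, sqDist]
    norm_num
    rw [intervalIntegral.integral_comp_add_right (fun s => |Real.cos s| ^ q),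
      show π + τ = (-π + τ) + 2 * π by ring, hp.intervalIntegral_add_eq _ (-π)]
    congr 1; ring
  rw [key, key]

lemma gradConst_eq (p : ℝ≥0∞) (q : ℝ) (z : ℂ) :
    gradConst p q z = 1 / π * extremalIntegral p q ‖z‖ ^ (1 / q) := by
  rcases eq_or_ne z 0 with rfl | hz
  · have h : dirConst q 0 0 = 1 / π * dirIntegral q 0 0 ^ (1 / q) := by
      simp [dirConst, dirIntegral, sqDist]
    rw [extremalIntegral, norm_zero, dirIntegral_zero_radius, ← h]
    simp [gradConst, normalDir, tangentDir]
  · unfold gradConst extremalIntegral extremalAngle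
    rw [normalDir_eq hz, tangentDir_eq hz, dirConst_circ, dirConst_circ]
    simp only [sub_self, add_sub_cancel_left]
    split_ifs <;> rfl

lemma gradConst_eq_dirConst (p : ℝ≥0∞) (q : ℝ) (z : ℂ) :
    gradConst p q z = dirConst q z (circ (z.arg + extremalAngle p)) := by
  rw [gradConst_eq, dirConst_circ, add_sub_cancel_left, extremalIntegral]

/-- The numerical relations between the conjugate exponents. -/
lemma exponent_relations {p : ℝ≥0∞} {q : ℝ}
    (hpq : ENNReal.HolderConjugate p (ENNReal.ofReal q)) :
    1 ≤ q ∧ (1 / p).toReal = 1 - 1 / q ∧ (p < 2 → 2 ≤ q) ∧ (2 ≤ p → q ≤ 2) := by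
  have h := ENNReal.HolderConjugate.inv_add_inv_eq_one p (ENNReal.ofReal q)
  have hq1 : 1 ≤ q := by
    have h1 : (ENNReal.ofReal q)⁻¹ ≤ 1 := by rw [← h]; exact le_add_self
    rw [ENNReal.inv_le_one] at h1
    rwa [ENNReal.one_le_ofReal] at h1
  have hp : p⁻¹ ≠ ∞ := fun h' => by simp [h'] at h
  have hq : (ENNReal.ofReal q)⁻¹ = ENNReal.ofReal q⁻¹ :=
    (ENNReal.ofReal_inv_of_pos (by linarith)).symm
  have h2 : p⁻¹.toReal = 1 - q⁻¹ := by
    have := congrArg ENNReal.toReal h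
    rw [ENNReal.toReal_add hp (by rw [hq]; exact ENNReal.ofReal_ne_top), hq,
      ENNReal.toReal_ofReal (by positivity), ENNReal.toReal_one] at this
    linarith
  refine ⟨hq1, by rw [one_div, one_div, h2], fun hp2 => ?_, fun hp2 => ?_⟩
  · have h3 : (2 : ℝ≥0∞)⁻¹ ≤ p⁻¹ := ENNReal.inv_le_inv.2 hp2.le
    have h4 := ENNReal.toReal_mono hp h3
    rw [h2, ENNReal.toReal_inv, ENNReal.toReal_ofNat] at h4
    exact (inv_le_inv₀ (by linarith) (by norm_num)).1 (by linarith)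
  · have h3 : p⁻¹ ≤ (2 : ℝ≥0∞)⁻¹ := ENNReal.inv_le_inv.2 hp2
    have h4 := ENNReal.toReal_mono (by simp) h3
    rw [h2, ENNReal.toReal_inv, ENNReal.toReal_ofNat] at h4
    exact (inv_le_inv₀ (by norm_num) (by linarith)).1 (by linarith)

lemma dirConst_le_of_dirIntegral_le {q r τ τ' : ℝ} (hq : 1 ≤ q)
    (h : dirIntegral q r τ ≤ dirIntegral q r τ') :
    1 / π * dirIntegral q r τ ^ (1 / q) ≤ 1 / π * dirIntegral q r τ' ^ (1 / q) :=
  mul_le_mul_of_nonneg_left (Real.rpow_le_rpow (dirIntegral_nonneg _ _ _) h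
    (by positivity)) (by positivity)

lemma dirConst_le_gradConst {p : ℝ≥0∞} {q : ℝ}
    (hpq : ENNReal.HolderConjugate p (ENNReal.ofReal q)) (z : ℂ) (τ : ℝ) :
    dirConst q z (circ τ) ≤ gradConst p q z := by
  obtain ⟨hq, -, h1, h2⟩ := exponent_relations hpq
  rw [dirConst_circ, gradConst_eq]
  refine dirConst_le_of_dirIntegral_le hq ?_
  unfold extremalAngle
  split_ifs with h
  · exact (dirIntegral_mem_of_two_le (h1 h) (norm_nonneg z) _).2
  · exact (dirIntegral_mem_of_le_two hq (h2 (not_lt.1 h)) (norm_nonneg z) _).2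

lemma monotoneOn_extremalIntegral {p : ℝ≥0∞} {q : ℝ}
    (hpq : ENNReal.HolderConjugate p (ENNReal.ofReal q)) :
    MonotoneOn (extremalIntegral p q) (Ico 0 1) := by
  obtain ⟨hq, -, h1, h2⟩ := exponent_relations hpq
  unfold extremalIntegral extremalAngle
  split_ifs with h
  · exact fun r hr r' _ hrr => dirIntegral_zero_mono (h1 h) hr.1 hrr
  · exact monotoneOn_dirIntegral_half_pi hq (h2 (not_lt.1 h))

/-- The extremal integral increases on `[0, 1)` and is continuous at `1`, so its supremum is the
value at `1`, even though `1` lies outside the disk. -/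
lemma isLUB_gradConst {p : ℝ≥0∞} {q : ℝ}
    (hpq : ENNReal.HolderConjugate p (ENNReal.ofReal q)) :
    IsLUB (gradConst p q '' ball (0 : ℂ) 1) (optConst p q) := by
  have hq := (exponent_relations hpq).1
  have hc : Continuous (extremalIntegral p q) := continuous_dirIntegral hq _
  have hlim : Tendsto (extremalIntegral p q) (𝓝[<] 1) (𝓝 (extremalIntegral p q 1)) :=
    (hc.tendsto 1).mono_left nhdsWithin_le_nhds
  have hnn : ∀ r, 0 ≤ extremalIntegral p q r := fun r => dirIntegral_nonneg _ _ _
  constructor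
  · rintro _ ⟨z, hz, rfl⟩
    have hz' : ‖z‖ < 1 := by simpa using hz
    rw [gradConst_eq, optConst_eq]
    refine mul_le_mul_of_nonneg_left (Real.rpow_le_rpow (hnn _) ?_ (by positivity)) (by positivity)
    refine ge_of_tendsto hlim ?_
    filter_upwards [Ioo_mem_nhdsLT hz'] with r hr
    exact monotoneOn_extremalIntegral hpq ⟨norm_nonneg z, hz'⟩
      ⟨(norm_nonneg z).trans hr.1.le, hr.2⟩ hr.1.le
  · intro b hb
    have hlim' := (hlim.rpow_const (p := 1 / q) (Or.inr (by positivity))).const_mul (1 / π)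
    rw [optConst_eq]
    refine le_of_tendsto hlim' ?_
    filter_upwards [Ioo_mem_nhdsLT (show (0 : ℝ) < 1 by norm_num)] with r hr
    have hn : ‖(r : ℂ)‖ = r := by simp [abs_of_pos hr.1]
    have := hb ⟨(r : ℂ), by simpa [abs_of_pos hr.1] using hr.2, rfl⟩
    rwa [gradConst_eq, hn] at this

lemma norm_fderiv_apply_le {p : ℝ≥0∞} {q : ℝ}
    (hpq : ENNReal.HolderConjugate p (ENNReal.ofReal q)) {w : ℂ → ℂ} (hw : MemHardy p w) {z : ℂ}
    (hz : z ∈ ball (0 : ℂ) 1) (τ : ℝ) :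
    ‖fderiv ℝ w z (circ τ)‖ ≤ dirConst q z (circ τ) * weight p z * (hardyNorm p w).toReal := by
  obtain ⟨hq, hpq', -⟩ := exponent_relations hpq
  rw [← kernelNorm_eq hq hpq' hz]
  exact norm_fderiv_apply_le_kernelNorm hq hpq hw hz _

lemma norm_fderiv_le {p : ℝ≥0∞} {q : ℝ}
    (hpq : ENNReal.HolderConjugate p (ENNReal.ofReal q)) {w : ℂ → ℂ} (hw : MemHardy p w) {z : ℂ}
    (hz : z ∈ ball (0 : ℂ) 1) :
    ‖fderiv ℝ w z‖ ≤ gradConst p q z * weight p z * (hardyNorm p w).toReal := by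
  have hwt := (weight_pos p hz).le
  have key : ∀ τ, ‖fderiv ℝ w z (circ τ)‖ ≤
      gradConst p q z * weight p z * (hardyNorm p w).toReal := fun τ => by
    refine (norm_fderiv_apply_le hpq hw hz τ).trans ?_
    gcongr
    exact dirConst_le_gradConst hpq z τ
  refine ContinuousLinearMap.opNorm_le_bound _ ((norm_nonneg _).trans (key 0)) fun v => ?_
  have hv : v = ‖v‖ • circ v.arg := by
    rw [Complex.real_smul, circ, Complex.norm_mul_exp_arg_mul_I]
  nth_rw 1 [hv]
  rw [map_smul, norm_smul, norm_norm, mul_comm]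
  exact mul_le_mul_of_nonneg_right (key _) (norm_nonneg v)

/-- Together with the next lemmas this transfers upper bounds from complex to real functions, and
real extremal functions to the complex problem. -/
lemma hardyNorm_ofReal (p : ℝ≥0∞) (u : ℂ → ℝ) :
    hardyNorm p (fun z => (u z : ℂ)) = hardyNorm p u := by
  refine iSup_congr fun ρ => iSup_congr fun _ =>
    eLpNorm_congr_norm_ae (Eventually.of_forall fun θ => ?_)
  exact Complex.norm_real _

lemma MemHardy.ofReal {p : ℝ≥0∞} {u : ℂ → ℝ} (hu : MemHardy p u) :
    MemHardy p fun z => (u z : ℂ) :=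
  ⟨hu.1.comp_CLM Complex.ofRealCLM, by rw [hardyNorm_ofReal]; exact hu.2⟩

lemma MemHardy.norm_fderiv_ofReal_apply {p : ℝ≥0∞} {u : ℂ → ℝ} (hu : MemHardy p u) {z : ℂ}
    (hz : z ∈ ball (0 : ℂ) 1) (l : ℂ) :
    ‖fderiv ℝ (fun z => (u z : ℂ)) z l‖ = ‖fderiv ℝ u z l‖ := by
  have h := (Complex.ofRealCLM.hasFDerivAt.comp z (hu.differentiableAt hz).hasFDerivAt).fderiv
  change ‖fderiv ℝ (Complex.ofRealCLM ∘ u) z l‖ = _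
  rw [h]
  simp

lemma MemHardy.norm_fderiv_le_ofReal {p : ℝ≥0∞} {u : ℂ → ℝ} (hu : MemHardy p u) {z : ℂ}
    (hz : z ∈ ball (0 : ℂ) 1) : ‖fderiv ℝ u z‖ ≤ ‖fderiv ℝ (fun z => (u z : ℂ)) z‖ :=
  ContinuousLinearMap.opNorm_le_bound _ (norm_nonneg _) fun v => by
    rw [← hu.norm_fderiv_ofReal_apply hz]
    exact ContinuousLinearMap.le_opNorm _ _

lemma norm_fderiv_real_le {p : ℝ≥0∞} {q : ℝ}
    (hpq : ENNReal.HolderConjugate p (ENNReal.ofReal q)) {u : ℂ → ℝ} (hu : MemHardy p u) {z : ℂ}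
    (hz : z ∈ ball (0 : ℂ) 1) :
    ‖fderiv ℝ u z‖ ≤ gradConst p q z * weight p z * (hardyNorm p u).toReal := by
  have h := norm_fderiv_le hpq hu.ofReal hz
  rw [hardyNorm_ofReal] at h
  exact (hu.norm_fderiv_le_ofReal hz).trans h

/-- Some real harmonic function attains equality in the gradient estimate at a given point. -/
lemma exists_gradConst_le {p : ℝ≥0∞} {q : ℝ} (hp : 1 ≤ p)
    (hpq : ENNReal.HolderConjugate p (ENNReal.ofReal q)) {z : ℂ} (hz : z ∈ ball (0 : ℂ) 1) :
    ∃ u : ℂ → ℝ, MemHardy p u ∧ ∀ C : ℝ,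
      ‖fderiv ℝ u z‖ ≤ C * weight p z * (hardyNorm p u).toReal → gradConst p q z ≤ C := by
  obtain ⟨hq, hpq', -⟩ := exponent_relations hpq
  obtain ⟨u, hu, h⟩ := exists_dirConst_le hp hq hpq' hz (z.arg + extremalAngle p)
  refine ⟨u, hu, fun C hC => ?_⟩
  rw [gradConst_eq_dirConst]
  refine h C (le_trans ?_ hC)
  simpa using (fderiv ℝ u z).le_opNorm (circ (z.arg + extremalAngle p))

lemma gradConst_closed_form {p : ℝ≥0∞} {q : ℝ}
    (hpq : ENNReal.HolderConjugate p (ENNReal.ofReal q)) (hp2 : 2 ≤ p) {z : ℂ}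
    (hz : z ∈ ball (0 : ℂ) 1) :
    gradConst p q z = 2 ^ (1 / q) / π *
      (ProbabilityTheory.beta ((1 + q) / 2) (1 / 2) *
        ordinaryHypergeometric (1 - 3 * q / 2) (1 - q) (1 + q / 2) (‖z‖ ^ 2)) ^ (1 / q) := by
  have hq := (exponent_relations hpq).1
  have hz' : ‖z‖ < 1 := by simpa using hz
  rw [gradConst_eq, extremalIntegral, extremalAngle, if_neg (not_lt.2 hp2), dirIntegral_half_pi hq,
    ← moment_eq_hypergeometric hq (norm_nonneg z) hz', Real.mul_rpow (by norm_num)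
      (moment_zero_pos hq (norm_nonneg z) hz').le]
  ring

end HarmonicHardy

end

open HarmonicHardy in
theorem theorem1 (p : ℝ≥0∞) (q : ℝ) (hp : 1 < p)
    (hpq : ENNReal.HolderConjugate p (ENNReal.ofReal q)) :
    (∀ z : ℂ, z ∈ ball (0 : ℂ) 1 → z ≠ 0 →
      -- the sharp directional estimate
      (∀ τ : ℝ, IsLeast
        {C : ℝ | ∀ w : ℂ → ℂ, MemHardy p w →
          ‖fderiv ℝ w z (Complex.exp (τ * Complex.I))‖ ≤
            C * weight p z * (hardyNorm p w).toReal}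
        (dirConst q z (Complex.exp (τ * Complex.I)))) ∧
      -- the sharp estimate of the norm of the differential
      IsLeast
        {C : ℝ | ∀ w : ℂ → ℂ, MemHardy p w →
          ‖fderiv ℝ w z‖ ≤ C * weight p z * (hardyNorm p w).toReal}
        (gradConst p q z) ∧
      -- the extremal directions
      (p < 2 → ∀ τ : ℝ,
        dirConst q z (tangentDir z) ≤ dirConst q z (Complex.exp (τ * Complex.I)) ∧
        dirConst q z (Complex.exp (τ * Complex.I)) ≤ dirConst q z (normalDir z)) ∧
      (2 ≤ p → ∀ τ : ℝ,
        dirConst q z (normalDir z) ≤ dirConst q z (Complex.exp (τ * Complex.I)) ∧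
        dirConst q z (Complex.exp (τ * Complex.I)) ≤ dirConst q z (tangentDir z)) ∧
      -- the closed form for `p ≥ 2`
      (2 ≤ p → gradConst p q z =
        2 ^ (1 / q) / Real.pi *
          (ProbabilityTheory.beta ((1 + q) / 2) (1 / 2) *
            ordinaryHypergeometric (1 - 3 * q / 2) (1 - q) (1 + q / 2) (‖z‖ ^ 2)) ^ (1 / q))) ∧
    -- the supremum over the disk
    IsLUB (gradConst p q '' ball (0 : ℂ) 1) (optConst p q) ∧
    -- its optimality, for complex and for real harmonic functions
    IsLeast
      {C : ℝ | ∀ w : ℂ → ℂ, MemHardy p w → ∀ z ∈ ball (0 : ℂ) 1,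
        ‖fderiv ℝ w z‖ ≤ C * weight p z * (hardyNorm p w).toReal}
      (optConst p q) ∧
    IsLeast
      {C : ℝ | ∀ u : ℂ → ℝ, MemHardy p u → ∀ z ∈ ball (0 : ℂ) 1,
        ‖fderiv ℝ u z‖ ≤ C * weight p z * (hardyNorm p u).toReal}
      (optConst p q) := by
  obtain ⟨hq, hpq', hlt, hge⟩ := exponent_relations hpq
  have hlub := isLUB_gradConst hpq
  have hopt : ∀ z ∈ ball (0 : ℂ) 1, gradConst p q z ≤ optConst p q :=
    fun z hz => hlub.1 ⟨z, hz, rfl⟩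
  have hmono : ∀ z ∈ ball (0 : ℂ) 1, ∀ h : ℝ≥0∞,
      gradConst p q z * weight p z * h.toReal ≤ optConst p q * weight p z * h.toReal :=
    fun z hz h => mul_le_mul_of_nonneg_right (mul_le_mul_of_nonneg_right (hopt z hz)
      (weight_pos p hz).le) ENNReal.toReal_nonneg
  refine ⟨fun z hz hz0 => ⟨fun τ => ⟨fun w hw => norm_fderiv_apply_le hpq hw hz τ, fun C hC => ?_⟩,
    ⟨fun w hw => norm_fderiv_le hpq hw hz, fun C hC => ?_⟩, fun h2 τ => ?_, fun h2 τ => ?_,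
    fun h2 => gradConst_closed_form hpq h2 hz⟩, hlub,
    ⟨fun w hw z hz => (norm_fderiv_le hpq hw hz).trans (hmono z hz _), fun C hC => ?_⟩,
    ⟨fun u hu z hz => (norm_fderiv_real_le hpq hu hz).trans (hmono z hz _), fun C hC => ?_⟩⟩
  · obtain ⟨u, hu, h⟩ := exists_dirConst_le hp.le hq hpq' hz τ
    have hu' := hC _ hu.ofReal
    rw [hardyNorm_ofReal, hu.norm_fderiv_ofReal_apply hz] at hu'
    exact h C hu'
  · obtain ⟨u, hu, h⟩ := exists_gradConst_le hp.le hpq hz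
    have hu' := hC _ hu.ofReal
    rw [hardyNorm_ofReal] at hu'
    exact h C ((hu.norm_fderiv_le_ofReal hz).trans hu')
  · have h := fun τ => dirIntegral_mem_of_two_le (hlt h2) (norm_nonneg z) τ
    change _ ≤ dirConst q z (circ τ) ∧ dirConst q z (circ τ) ≤ _
    rw [normalDir_eq hz0, tangentDir_eq hz0, dirConst_circ, dirConst_circ, dirConst_circ,
      sub_self, add_sub_cancel_left]
    exact ⟨dirConst_le_of_dirIntegral_le hq (h _).1, dirConst_le_of_dirIntegral_le hq (h _).2⟩
  · have h := fun τ => dirIntegral_mem_of_le_two hq (hge h2) (norm_nonneg z) τ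
    change _ ≤ dirConst q z (circ τ) ∧ dirConst q z (circ τ) ≤ _
    rw [normalDir_eq hz0, tangentDir_eq hz0, dirConst_circ, dirConst_circ, dirConst_circ,
      sub_self, add_sub_cancel_left]
    exact ⟨dirConst_le_of_dirIntegral_le hq (h _).1, dirConst_le_of_dirIntegral_le hq (h _).2⟩
  -- An admissible global constant is admissible at each `z`, so it dominates every `gradConst p q
  -- z` and hence their least upper bound.
  · refine hlub.2 ?_
    rintro _ ⟨z, hz, rfl⟩
    obtain ⟨u, hu, h⟩ := exists_gradConst_le hp.le hpq hz
    have hu' := hC _ hu.ofReal z hz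
    rw [hardyNorm_ofReal] at hu'
    exact h C ((hu.norm_fderiv_le_ofReal hz).trans hu')
  · refine hlub.2 ?_
    rintro _ ⟨z, hz, rfl⟩
    obtain ⟨u, hu, h⟩ := exists_gradConst_le hp.le hpq hz
    exact h C (hC u hu z hz)
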